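/- Let $k$ be a field, $A$ an associative unital $k$-algebra, $B$ a commutative unital $k$-algebra, and $\varepsilon:B\to A$ a morphism of $k$-algebras whose image lies in the center of $A$. For $n\ge 0$ let $$C^n=C^n((A,B,\varepsilon);A)=\mathrm{Hom}_k\bigl(A^{\otimes n}\otimes B^{\otimes n(n-1)/2},A\bigr),$$ and write a pure tensor in $A^{\otimes n}\otimes B^{\otimes n(n-1)/2}$ as an upper triangular matrix $T$ with diagonal entries $a_i\in A$ ($1\le i\le n$) and entries $b_{i,j}\in B$ ($1\le i<j\le n$) above the diagonal. For $0\le p\le q\le n$ let $T^p_q$ be the submatrix on the rows and columns $p+1,\dots,q$. For $T$ of size $n+1$ and $1\le i\le n$ let $M_{i,i+1}$ be the matrix of size $n$ obtained from $T$ by merging the rows $i,i+1$ and the columns $i,i+1$: the $i$-th diagonal entry becomes $\varepsilon(b_{i,i+1})a_ia_{i+1}$, the entries above it become $b_{l,i}b_{l,i+1}$ $(l<i)$, the entries to the right of it become $b_{i,j}b_{i+1,j}$ $(j>i+1)$, and all other entries are unchanged. The differential $\delta^\varepsilon_n:C^n\to C^{n+1}$ is $$\delta^\varepsilon_n(f)(T)=a_1\,\varepsilon\Bigl(\prod_{j=2}^{n+1}b_{1,j}\Bigr)f(T^1_{n+1})+\sum_{i=1}^n(-1)^i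 f(M_{i,i+1})+(-1)^{n+1}f(T^0_n)\,a_{n+1}\,\varepsilon\Bigl(\prod_{i=1}^{n}b_{i,n+1}\Bigr),$$ and the secondary Hochschild cohomology $H^n((A,B,\varepsilon);A)$ is $\ker\delta^\varepsilon_n/\mathrm{im}\,\delta^\varepsilon_{n-1}$ (with $\mathrm{im}\,\delta^\varepsilon_{-1}=0$). The cup product of $f\in C^m$ and $g\in C^n$ is the cochain $f\smile g\in C^{m+n}$ with $$(f\smile g)(T)=f(T^0_m)\;\varepsilon\Bigl(\prod_{\substack{1\le i\le m\\ m+1\le j\le m+n}}b_{i,j}\Bigr)\;g(T^m_{m+n}).$$ It induces a product on cohomology by $[f]\smile[g]=[f\smile g]$, and, extended bilinearly, a product on $H^*((A,B,\varepsilon);A)=\bigoplus_{n\ge0}H^n((A,B,\varepsilon);A)$. Then this cup product is graded commutative: for all $m,n\ge 0$, $x\in H^m((A,B,\varepsilon);A)$ and $y\in H^n((A,B,\varepsilon);A)$, $$x\smile y=(-1)^{mn}\,y\smile x .$$ -/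

import Mathlib

open scoped TensorProduct DirectSum

noncomputable section

namespace SecondaryHochschild

/-- The positions strictly above the diagonal of an `n × n` matrix (there are `n(n-1)/2`). -/
abbrev Pair (n : ℕ) : Type := {p : Fin n × Fin n // p.1 < p.2}

/-- The position `(i, j)`, for `i < j`. -/
abbrev pr {n : ℕ} (i j : Fin n) (h : i < j) : Pair n := ⟨(i, j), h⟩

theorem castAdd_lt_natAdd {m n : ℕ} (i : Fin m) (j : Fin n) :
    Fin.castAdd n i < Fin.natAdd m j := by
  rw [Fin.lt_def, Fin.val_castAdd, Fin.val_natAdd]; omega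

theorem strictMono_castAdd {m : ℕ} (n : ℕ) : StrictMono (Fin.castAdd n : Fin m → Fin (m + n)) :=
  fun _ _ h => h

/-- The image of a position under a strictly monotone map of indices. -/
def Pair.map {m n : ℕ} (φ : Fin m → Fin n) (hφ : StrictMono φ) (p : Pair m) : Pair n :=
  ⟨(φ p.1.1, φ p.1.2), hφ p.2⟩

section Cochains

variable (k A B : Type*) [CommRing k] [Ring A] [Algebra k A] [CommRing B] [Algebra k B]

/-- The `n`-cochains `Hom_k(A^{⊗ n} ⊗ B^{⊗ n(n-1)/2}, A)`. The factors `B` are indexed by the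
positions above the diagonal. -/
def Cochain (n : ℕ) : Type _ :=
  ((⨂[k] _ : Fin n, A) ⊗[k] (⨂[k] _ : Pair n, B)) →ₗ[k] A

instance (n : ℕ) : AddCommGroup (Cochain k A B n) :=
  inferInstanceAs (AddCommGroup (((⨂[k] _ : Fin n, A) ⊗[k] (⨂[k] _ : Pair n, B)) →ₗ[k] A))

instance (n : ℕ) : Module k (Cochain k A B n) :=
  inferInstanceAs (Module k (((⨂[k] _ : Fin n, A) ⊗[k] (⨂[k] _ : Pair n, B)) →ₗ[k] A))

/-- A cochain as a linear map on the tensor product. -/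
def Cochain.toLin {k A B : Type*} [CommRing k] [Ring A] [Algebra k A] [CommRing B] [Algebra k B]
    {n : ℕ} (f : Cochain k A B n) :
    ((⨂[k] _ : Fin n, A) ⊗[k] (⨂[k] _ : Pair n, B)) →ₗ[k] A := f

variable {k A B}

/-- The value of a cochain on the pure tensor with diagonal entries `a i` and entries `b (i, j)`
above the diagonal. -/
def ev {n : ℕ} (f : Cochain k A B n) (a : Fin n → A) (b : Pair n → B) : A :=
  f.toLin (PiTensorProduct.tprod k a ⊗ₜ[k] PiTensorProduct.tprod k b)

theorem ev_ext {n : ℕ} {f g : Cochain k A B n} (h : ∀ a b, ev f a b = ev g a b) : f = g := by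
  apply TensorProduct.ext
  apply PiTensorProduct.ext
  ext a : 1
  apply PiTensorProduct.ext
  ext b
  exact h a b

@[simp] theorem ev_add {n : ℕ} (f g : Cochain k A B n) (a b) :
    ev (f + g) a b = ev f a b + ev g a b := rfl

@[simp] theorem ev_smul {n : ℕ} (c : k) (f : Cochain k A B n) (a b) :
    ev (c • f) a b = c • ev f a b := rfl

@[simp] theorem ev_zero {n : ℕ} (a b) : ev (0 : Cochain k A B n) a b = 0 := rfl

/-- `F` is `k`-linear in each entry of the tensor matrix separately. -/
structure IsMultilinear (k : Type*) {A B : Type*} [CommRing k] [Ring A] [Algebra k A]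
    [CommRing B] [Algebra k B] {n : ℕ} (F : (Fin n → A) → (Pair n → B) → A) : Prop where
  left : ∀ a b i, ∃ L : A →ₗ[k] A, ∀ x, F (Function.update a i x) b = L x
  right : ∀ a b r, ∃ L : B →ₗ[k] A, ∀ x, F a (Function.update b r x) = L x

theorem isMultilinear_ev {n : ℕ} (f : Cochain k A B n) : IsMultilinear k (ev f) where
  left a b i := ⟨(f.toLin ∘ₗ (TensorProduct.mk k _ _).flip (PiTensorProduct.tprod k b)) ∘ₗ
      (PiTensorProduct.tprod k).toLinearMap a i, fun _ => rfl⟩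
  right a b r := ⟨(f.toLin ∘ₗ TensorProduct.mk k _ _ (PiTensorProduct.tprod k a)) ∘ₗ
      (PiTensorProduct.tprod k).toLinearMap b r, fun _ => rfl⟩

/-- The cochain determined by a multilinear function of the entries. -/
def mk {n : ℕ} (F : (Fin n → A) → (Pair n → B) → A) (hF : IsMultilinear k F) :
    Cochain k A B n :=
  TensorProduct.lift <| PiTensorProduct.lift
    { toFun := fun a => PiTensorProduct.lift
        { toFun := fun b => F a b
          map_update_add' := by
            intro inst b r x y
            obtain rfl : inst = Subtype.instDecidableEq := Subsingleton.elim _ _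
            obtain ⟨L, hL⟩ := hF.right a b r
            exact (hL _).trans ((map_add L x y).trans (congrArg₂ _ (hL x).symm (hL y).symm))
          map_update_smul' := by
            intro inst b r c x
            obtain rfl : inst = Subtype.instDecidableEq := Subsingleton.elim _ _
            obtain ⟨L, hL⟩ := hF.right a b r
            exact (hL _).trans ((map_smul L c x).trans (congrArg _ (hL x).symm)) }
      map_update_add' := by
        intro inst a i x y
        obtain rfl : inst = instDecidableEqFin n := Subsingleton.elim _ _
        ext b
        obtain ⟨L, hL⟩ := hF.left a b i
        simpa using
          (hL _).trans ((map_add L x y).trans (congrArg₂ _ (hL x).symm (hL y).symm))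
      map_update_smul' := by
        intro inst a i c x
        obtain rfl : inst = instDecidableEqFin n := Subsingleton.elim _ _
        ext b
        obtain ⟨L, hL⟩ := hF.left a b i
        simpa using (hL _).trans ((map_smul L c x).trans (congrArg _ (hL x).symm)) }

@[simp] theorem ev_mk {n : ℕ} (F : (Fin n → A) → (Pair n → B) → A) (hF : IsMultilinear k F)
    (a b) : ev (mk F hF) a b = F a b := by
  simp [ev, mk, Cochain.toLin]

namespace IsMultilinear

variable {n : ℕ} {F G : (Fin n → A) → (Pair n → B) → A}

theorem add (hF : IsMultilinear k F) (hG : IsMultilinear k G) :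
    IsMultilinear k (fun a b => F a b + G a b) where
  left a b i := by
    obtain ⟨L, hL⟩ := hF.left a b i
    obtain ⟨M, hM⟩ := hG.left a b i
    exact ⟨L + M, fun x => by simp [hL, hM]⟩
  right a b i := by
    obtain ⟨L, hL⟩ := hF.right a b i
    obtain ⟨M, hM⟩ := hG.right a b i
    exact ⟨L + M, fun x => by simp [hL, hM]⟩

theorem smul (c : k) (hF : IsMultilinear k F) : IsMultilinear k (fun a b => c • F a b) where
  left a b i := by
    obtain ⟨L, hL⟩ := hF.left a b i
    exact ⟨c • L, fun x => by simp [hL]⟩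
  right a b i := by
    obtain ⟨L, hL⟩ := hF.right a b i
    exact ⟨c • L, fun x => by simp [hL]⟩

theorem sum {ι : Type*} (s : Finset ι) {F : ι → (Fin n → A) → (Pair n → B) → A}
    (hF : ∀ i, IsMultilinear k (F i)) : IsMultilinear k (fun a b => ∑ i ∈ s, F i a b) where
  left a b i := by
    choose L hL using fun j => (hF j).left a b i
    exact ⟨∑ j ∈ s, L j, fun x => by simp [hL]⟩
  right a b i := by
    choose L hL using fun j => (hF j).right a b i
    exact ⟨∑ j ∈ s, L j, fun x => by simp [hL]⟩

end IsMultilinear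

end Cochains

section Complex

variable {k A B : Type*} [CommRing k] [Ring A] [Algebra k A] [CommRing B] [Algebra k B]
  (ε : B →ₐ[k] A)

/-- The diagonal of the matrix obtained by merging the rows and columns `i` and `i + 1`:
the `i`-th entry is `ε(b_{i,i+1}) a_i a_{i+1}`. -/
def mergeDiag {n : ℕ} (i : Fin n) (a : Fin (n + 1) → A) (b : Pair (n + 1) → B) : Fin n → A :=
  fun j =>
    if j < i then a j.castSucc
    else if j = i then
      ε (b (pr i.castSucc i.succ i.castSucc_lt_succ)) * a i.castSucc * a i.succ
    else a j.succ

/-- The part above the diagonal of the matrix obtained by merging the rows and columns `i` and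
`i + 1`. The map `i.predAbove` sends both `i` and `i + 1` to `i`, and is otherwise the monotone
bijection; the entry at `(p, q)` is the product of all entries at positions over `(p, q)`. -/
def mergeUpper {n : ℕ} (i : Fin n) (b : Pair (n + 1) → B) : Pair n → B :=
  fun p => ∏ r : Pair (n + 1) with
    i.predAbove r.1.1 = p.1.1 ∧ i.predAbove r.1.2 = p.1.2, b r

/-- The first term of the differential, `a_1 ε(b_{1,2} ⋯ b_{1,n+1}) f(T^1_{n+1})`. -/
def firstTerm {n : ℕ} (f : Cochain k A B n) (a : Fin (n + 1) → A) (b : Pair (n + 1) → B) : A :=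
  a 0 * ε (∏ j : Fin n, b (pr 0 j.succ j.succ_pos)) *
    ev f (fun i => a i.succ) (fun p => b (p.map Fin.succ Fin.strictMono_succ))

/-- The last term of the differential (without sign),
`f(T^0_n) a_{n+1} ε(b_{1,n+1} ⋯ b_{n,n+1})`. -/
def lastTerm {n : ℕ} (f : Cochain k A B n) (a : Fin (n + 1) → A) (b : Pair (n + 1) → B) : A :=
  ev f (fun i => a i.castSucc) (fun p => b (p.map Fin.castSucc Fin.strictMono_castSucc)) *
    a (Fin.last n) * ε (∏ i : Fin n, b (pr i.castSucc (Fin.last n) i.castSucc_lt_last))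

/-- The differential on a tensor matrix; indices start at `0`, so that the sign of the term in
which the rows and columns `i` and `i + 1` are merged is `(-1)^(i+1)`. -/
def dFun {n : ℕ} (f : Cochain k A B n) (a : Fin (n + 1) → A) (b : Pair (n + 1) → B) : A :=
  firstTerm ε f a b
    + ∑ i : Fin n, (-1 : k) ^ ((i : ℕ) + 1) • ev f (mergeDiag ε i a b) (mergeUpper i b)
    + (-1 : k) ^ (n + 1) • lastTerm ε f a b

/-- The cup product on a tensor matrix,
`f(T^0_m) (∏_{i ≤ m < j} ε(b_{i,j})) g(T^m_{m+n})`. -/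
def cupFun {m n : ℕ} (f : Cochain k A B m) (g : Cochain k A B n)
    (a : Fin (m + n) → A) (b : Pair (m + n) → B) : A :=
  ev f (fun i => a (Fin.castAdd n i)) (fun p => b (p.map (Fin.castAdd n)
      (strictMono_castAdd n))) *
    ε (∏ ij : Fin m × Fin n, b (pr (Fin.castAdd n ij.1) (Fin.natAdd m ij.2)
      (castAdd_lt_natAdd ij.1 ij.2))) *
    ev g (fun i => a (Fin.natAdd m i)) (fun p => b (p.map (Fin.natAdd m)
      (Fin.strictMono_natAdd m)))

/-! Multilinearity of the terms above. -/

theorem comp_update_of_injective {ι κ R : Type*} [DecidableEq ι] [DecidableEq κ] {φ : ι → κ}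
    (hφ : Function.Injective φ) (a : κ → R) (j : ι) (x : R) :
    (fun i => Function.update a (φ j) x (φ i)) = Function.update (fun i => a (φ i)) j x :=
  Function.update_comp_eq_of_injective a hφ j x

theorem comp_update_of_notMem {ι κ R : Type*} [DecidableEq κ] {φ : ι → κ}
    (a : κ → R) {r : κ} (hr : ∀ i, φ i ≠ r) (x : R) :
    (fun i => Function.update a r x (φ i)) = fun i => a (φ i) :=
  funext fun i => Function.update_of_ne (hr i) _ _

theorem prod_comp_update {ι κ : Type*} [Fintype ι] [DecidableEq ι] [DecidableEq κ] {φ : ι → κ}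
    (hφ : Function.Injective φ) (b : κ → B) (j : ι) :
    ∃ c : B, ∀ x, ∏ i, Function.update b (φ j) x (φ i) = x * c := by
  refine ⟨∏ i ∈ Finset.univ \ {j}, b (φ i), fun x => ?_⟩
  rw [comp_update_of_injective hφ, Finset.prod_update_of_mem (Finset.mem_univ j)]

theorem Pair.map_injective {m n : ℕ} {φ : Fin m → Fin n} (hφ : StrictMono φ) :
    Function.Injective (Pair.map φ hφ) := by
  intro p q h
  simp only [Pair.map, Subtype.mk.injEq, Prod.mk.injEq, hφ.injective.eq_iff] at h
  exact Subtype.ext (Prod.ext h.1 h.2)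

theorem isMultilinear_firstTerm {n : ℕ} (f : Cochain k A B n) :
    IsMultilinear k (firstTerm ε f) where
  left a b i := by
    unfold firstTerm
    induction i using Fin.cases with
    | zero =>
      refine ⟨LinearMap.mulRight k (ε (∏ j : Fin n, b (pr 0 j.succ j.succ_pos)) *
        ev f (fun i => a i.succ) (fun p => b (p.map Fin.succ Fin.strictMono_succ))),
        fun x => ?_⟩
      rw [comp_update_of_notMem _ (fun i => Fin.succ_ne_zero i)]
      simp [mul_assoc]
    | succ i =>
      obtain ⟨L, hL⟩ := (isMultilinear_ev f).left (fun i => a i.succ)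
        (fun p => b (p.map Fin.succ Fin.strictMono_succ)) i
      refine ⟨LinearMap.mulLeft k (a 0 * ε (∏ j : Fin n, b (pr 0 j.succ j.succ_pos))) ∘ₗ L,
        fun x => ?_⟩
      rw [comp_update_of_injective (Fin.succ_injective n), hL,
        Function.update_of_ne (Fin.succ_ne_zero i).symm]
      simp [mul_assoc]
  right a b r := by
    unfold firstTerm
    obtain ⟨⟨p, q⟩, h⟩ := r
    obtain ⟨q, rfl⟩ := Fin.exists_succ_eq.2 (ne_of_gt (lt_of_le_of_lt (Fin.zero_le p) h))
    induction p using Fin.cases with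
    | zero =>
      obtain ⟨c, hc⟩ := prod_comp_update (φ := fun j : Fin n => pr 0 j.succ j.succ_pos)
        (fun i j hij => by simpa using hij) b q
      refine ⟨LinearMap.mulLeft k (a 0) ∘ₗ LinearMap.mulRight k (ε c *
        ev f (fun i => a i.succ) (fun p => b (p.map Fin.succ Fin.strictMono_succ))) ∘ₗ
        ε.toLinearMap, fun x => ?_⟩
      rw [hc, comp_update_of_notMem]
      · simp [mul_assoc]
      · intro p hp
        simp [Pair.map] at hp
    | succ p =>
      have hpq : p < q := Fin.succ_lt_succ_iff.1 h
      obtain ⟨L, hL⟩ := (isMultilinear_ev f).right (fun i => a i.succ)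
        (fun p => b (p.map Fin.succ Fin.strictMono_succ)) (pr p q hpq)
      refine ⟨LinearMap.mulLeft k (a 0 * ε (∏ j : Fin n, b (pr 0 j.succ j.succ_pos))) ∘ₗ L,
        fun x => ?_⟩
      have h1 := comp_update_of_injective (Pair.map_injective Fin.strictMono_succ) b
        (pr p q hpq) x
      have h2 := comp_update_of_notMem (φ := fun j : Fin n => pr 0 j.succ j.succ_pos) b
        (r := pr p.succ q.succ h) (fun i hi => by simp [Fin.ext_iff] at hi) x
      have h2' := congrArg (fun u : Fin n → B => ∏ i, u i) h2
      change _ * ε (∏ j : Fin n, Function.update b (pr p.succ q.succ h) x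
        (pr 0 j.succ j.succ_pos)) * ev f _ (fun i => Function.update b
        (Pair.map Fin.succ Fin.strictMono_succ (pr p q hpq)) x _) = _
      rw [h1, hL, h2']
      simp [mul_assoc]

theorem isMultilinear_lastTerm {n : ℕ} (f : Cochain k A B n) :
    IsMultilinear k (lastTerm ε f) where
  left a b i := by
    unfold lastTerm
    induction i using Fin.lastCases with
    | last =>
      refine ⟨LinearMap.mulLeft k (ev f (fun i => a i.castSucc)
        (fun p => b (p.map Fin.castSucc Fin.strictMono_castSucc))) ∘ₗ LinearMap.mulRight k
        (ε (∏ i : Fin n, b (pr i.castSucc (Fin.last n) i.castSucc_lt_last))), fun x => ?_⟩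
      rw [comp_update_of_notMem _ (fun i => (Fin.castSucc_lt_last i).ne)]
      simp [mul_assoc]
    | cast i =>
      obtain ⟨L, hL⟩ := (isMultilinear_ev f).left (fun i => a i.castSucc)
        (fun p => b (p.map Fin.castSucc Fin.strictMono_castSucc)) i
      refine ⟨LinearMap.mulRight k (a (Fin.last n) *
        ε (∏ i : Fin n, b (pr i.castSucc (Fin.last n) i.castSucc_lt_last))) ∘ₗ L, fun x => ?_⟩
      rw [comp_update_of_injective (Fin.castSucc_injective n), hL,
        Function.update_of_ne (Fin.castSucc_lt_last i).ne']
      simp [mul_assoc]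
  right a b r := by
    unfold lastTerm
    obtain ⟨⟨p, q⟩, h⟩ := r
    obtain ⟨p, rfl⟩ := Fin.exists_castSucc_eq.2 (ne_of_lt (lt_of_lt_of_le h (Fin.le_last q)))
    induction q using Fin.lastCases with
    | last =>
      obtain ⟨c, hc⟩ := prod_comp_update
        (φ := fun i : Fin n => pr i.castSucc (Fin.last n) i.castSucc_lt_last)
        (fun i j hij => by simpa using hij) b p
      refine ⟨LinearMap.mulLeft k (ev f (fun i => a i.castSucc)
        (fun p => b (p.map Fin.castSucc Fin.strictMono_castSucc)) * a (Fin.last n)) ∘ₗ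
        LinearMap.mulRight k (ε c) ∘ₗ ε.toLinearMap, fun x => ?_⟩
      rw [hc, comp_update_of_notMem]
      · simp [mul_assoc]
      · intro p hp
        simp [Pair.map, (Fin.castSucc_lt_last _).ne] at hp
    | cast q =>
      have hpq : p < q := h
      obtain ⟨L, hL⟩ := (isMultilinear_ev f).right (fun i => a i.castSucc)
        (fun p => b (p.map Fin.castSucc Fin.strictMono_castSucc)) (pr p q hpq)
      refine ⟨LinearMap.mulRight k (a (Fin.last n) *
        ε (∏ i : Fin n, b (pr i.castSucc (Fin.last n) i.castSucc_lt_last))) ∘ₗ L, fun x => ?_⟩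
      have h1 := comp_update_of_injective (Pair.map_injective Fin.strictMono_castSucc) b
        (pr p q hpq) x
      have h2 := comp_update_of_notMem
        (φ := fun i : Fin n => pr i.castSucc (Fin.last n) i.castSucc_lt_last) b
        (r := pr p.castSucc q.castSucc h)
        (fun i hi => by simp [(Fin.castSucc_lt_last _).ne'] at hi) x
      have h2' := congrArg (fun u : Fin n → B => ∏ i, u i) h2
      change ev f _ (fun i => Function.update b
        (Pair.map Fin.castSucc Fin.strictMono_castSucc (pr p q hpq)) x _) * _ *
        ε (∏ i : Fin n, Function.update b (pr p.castSucc q.castSucc h) x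
        (pr i.castSucc (Fin.last n) i.castSucc_lt_last)) = _
      rw [h1, hL, h2']
      simp [mul_assoc]

theorem isMultilinear_cupFun {m n : ℕ} (f : Cochain k A B m) (g : Cochain k A B n) :
    IsMultilinear k (cupFun ε f g) where
  left a b i := by
    unfold cupFun
    set c := ε (∏ ij : Fin m × Fin n, b (pr (Fin.castAdd n ij.1) (Fin.natAdd m ij.2)
      (castAdd_lt_natAdd ij.1 ij.2)))
    induction i using Fin.addCases with
    | left i =>
      obtain ⟨L, hL⟩ := (isMultilinear_ev f).left (fun i => a (Fin.castAdd n i))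
        (fun p => b (p.map (Fin.castAdd n) (strictMono_castAdd n))) i
      refine ⟨LinearMap.mulRight k (c * ev g (fun i => a (Fin.natAdd m i))
        (fun p => b (p.map (Fin.natAdd m) (Fin.strictMono_natAdd m)))) ∘ₗ L, fun x => ?_⟩
      rw [comp_update_of_injective (strictMono_castAdd n).injective, hL,
        comp_update_of_notMem _ (fun j => (castAdd_lt_natAdd i j).ne')]
      simp [mul_assoc]
    | right i =>
      obtain ⟨L, hL⟩ := (isMultilinear_ev g).left (fun i => a (Fin.natAdd m i))
        (fun p => b (p.map (Fin.natAdd m) (Fin.strictMono_natAdd m))) i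
      refine ⟨LinearMap.mulLeft k (ev f (fun i => a (Fin.castAdd n i))
        (fun p => b (p.map (Fin.castAdd n) (strictMono_castAdd n))) * c) ∘ₗ L,
        fun x => ?_⟩
      rw [comp_update_of_injective (Fin.strictMono_natAdd m).injective, hL,
        comp_update_of_notMem _ (fun j => (castAdd_lt_natAdd j i).ne)]
      simp [mul_assoc]
  right a b r := by
    unfold cupFun
    obtain ⟨⟨p, q⟩, h⟩ := r
    set φ : Fin m × Fin n → Pair (m + n) := fun ij => pr (Fin.castAdd n ij.1)
      (Fin.natAdd m ij.2) (castAdd_lt_natAdd ij.1 ij.2) with hφ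
    have hφi : Function.Injective φ := by
      intro x y hxy
      simp only [hφ, pr, Subtype.mk.injEq, Prod.mk.injEq,
        (strictMono_castAdd n).injective.eq_iff,
        (Fin.strictMono_natAdd m).injective.eq_iff] at hxy
      exact Prod.ext hxy.1 hxy.2
    induction p using Fin.addCases with
    | left p =>
      induction q using Fin.addCases with
      | left q =>
        have hpq : p < q := h
        obtain ⟨L, hL⟩ := (isMultilinear_ev f).right (fun i => a (Fin.castAdd n i))
          (fun p => b (p.map (Fin.castAdd n) (strictMono_castAdd n))) (pr p q hpq)
        refine ⟨LinearMap.mulRight k (ε (∏ ij, b (φ ij)) * ev g (fun i => a (Fin.natAdd m i))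
          (fun p => b (p.map (Fin.natAdd m) (Fin.strictMono_natAdd m)))) ∘ₗ L, fun x => ?_⟩
        have h1 := comp_update_of_injective (Pair.map_injective (strictMono_castAdd n)) b
          (pr p q hpq) x
        have h2 := comp_update_of_notMem (φ := φ) b
          (r := Pair.map (Fin.castAdd n) (strictMono_castAdd n) (pr p q hpq))
          (fun i hi => (castAdd_lt_natAdd q i.2).ne'
            (congrArg (fun r : Pair (m + n) => r.1.2) hi)) x
        have h2' := congrArg (fun u : Fin m × Fin n → B => ∏ i, u i) h2
        have h3 := comp_update_of_notMem
          (φ := Pair.map (Fin.natAdd m) (Fin.strictMono_natAdd m)) b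
          (r := Pair.map (Fin.castAdd n) (strictMono_castAdd n) (pr p q hpq))
          (fun i hi => (castAdd_lt_natAdd p i.1.1).ne'
            (congrArg (fun r : Pair (m + n) => r.1.1) hi)) x
        change ev f _ (fun i => Function.update b
          (Pair.map (Fin.castAdd n) (strictMono_castAdd n) (pr p q hpq)) x _) *
          ε (∏ ij, Function.update b
          (Pair.map (Fin.castAdd n) (strictMono_castAdd n) (pr p q hpq)) x (φ ij)) *
          ev g _ (fun i => Function.update b
          (Pair.map (Fin.castAdd n) (strictMono_castAdd n) (pr p q hpq)) x _) = _
        rw [h1, hL, h2', h3]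
        simp [mul_assoc]
      | right q =>
        obtain ⟨c, hc⟩ := prod_comp_update hφi b (p, q)
        refine ⟨LinearMap.mulLeft k (ev f (fun i => a (Fin.castAdd n i))
          (fun p => b (p.map (Fin.castAdd n) (strictMono_castAdd n)))) ∘ₗ
          LinearMap.mulRight k (ε c * ev g (fun i => a (Fin.natAdd m i))
          (fun p => b (p.map (Fin.natAdd m) (Fin.strictMono_natAdd m)))) ∘ₗ ε.toLinearMap,
          fun x => ?_⟩
        have h2 := comp_update_of_notMem
          (φ := Pair.map (Fin.castAdd n) (strictMono_castAdd n)) b (r := φ (p, q))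
          (fun i hi => (castAdd_lt_natAdd i.1.2 q).ne
            (congrArg (fun r : Pair (m + n) => r.1.2) hi)) x
        have h3 := comp_update_of_notMem
          (φ := Pair.map (Fin.natAdd m) (Fin.strictMono_natAdd m)) b (r := φ (p, q))
          (fun i hi => (castAdd_lt_natAdd p i.1.1).ne'
            (congrArg (fun r : Pair (m + n) => r.1.1) hi)) x
        change ev f _ (fun i => Function.update b (φ (p, q)) x _) *
          ε (∏ ij, Function.update b (φ (p, q)) x (φ ij)) *
          ev g _ (fun i => Function.update b (φ (p, q)) x _) = _
        rw [h2, hc, h3]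
        simp [mul_assoc]
    | right p =>
      induction q using Fin.addCases with
      | left q => exact absurd h (castAdd_lt_natAdd q p).not_gt
      | right q =>
        have hpq : p < q := (Fin.strictMono_natAdd m).lt_iff_lt.1 h
        obtain ⟨L, hL⟩ := (isMultilinear_ev g).right (fun i => a (Fin.natAdd m i))
          (fun p => b (p.map (Fin.natAdd m) (Fin.strictMono_natAdd m))) (pr p q hpq)
        refine ⟨LinearMap.mulLeft k (ev f (fun i => a (Fin.castAdd n i))
          (fun p => b (p.map (Fin.castAdd n) (strictMono_castAdd n))) *
          ε (∏ ij, b (φ ij))) ∘ₗ L, fun x => ?_⟩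
        have h1 := comp_update_of_injective (Pair.map_injective (Fin.strictMono_natAdd m)) b
          (pr p q hpq) x
        have h2 := comp_update_of_notMem (φ := φ) b
          (r := Pair.map (Fin.natAdd m) (Fin.strictMono_natAdd m) (pr p q hpq))
          (fun i hi => (castAdd_lt_natAdd i.1 p).ne
            (congrArg (fun r : Pair (m + n) => r.1.1) hi)) x
        have h2' := congrArg (fun u : Fin m × Fin n → B => ∏ i, u i) h2
        have h3 := comp_update_of_notMem
          (φ := Pair.map (Fin.castAdd n) (strictMono_castAdd n)) b
          (r := Pair.map (Fin.natAdd m) (Fin.strictMono_natAdd m) (pr p q hpq))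
          (fun i hi => (castAdd_lt_natAdd i.1.1 p).ne
            (congrArg (fun r : Pair (m + n) => r.1.1) hi)) x
        change ev f _ (fun i => Function.update b
          (Pair.map (Fin.natAdd m) (Fin.strictMono_natAdd m) (pr p q hpq)) x _) *
          ε (∏ ij, Function.update b
          (Pair.map (Fin.natAdd m) (Fin.strictMono_natAdd m) (pr p q hpq)) x (φ ij)) *
          ev g _ (fun i => Function.update b
          (Pair.map (Fin.natAdd m) (Fin.strictMono_natAdd m) (pr p q hpq)) x _) = _
        rw [h1, hL, h2', h3]
        simp [mul_assoc]

theorem mergeDiag_update_left {n : ℕ} (i : Fin n) (a : Fin (n + 1) → A) (b : Pair (n + 1) → B)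
    (j : Fin (n + 1)) : ∃ (j' : Fin n) (L : A →ₗ[k] A), ∀ x,
      mergeDiag ε i (Function.update a j x) b = Function.update (mergeDiag ε i a b) j' (L x) := by
  set e := ε (b (pr i.castSucc i.succ i.castSucc_lt_succ)) with he
  by_cases h1 : j = i.castSucc
  · refine ⟨i, LinearMap.mulLeft k e ∘ₗ LinearMap.mulRight k (a i.succ), fun x => ?_⟩
    subst h1
    funext t
    simp only [mergeDiag, Function.update_apply, ← he, LinearMap.comp_apply,
      LinearMap.mulLeft_apply, LinearMap.mulRight_apply, Fin.ext_iff, Fin.lt_def,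
      Fin.val_castSucc, Fin.val_succ]
    split_ifs <;> first | omega | simp [mul_assoc]
  · by_cases h2 : j = i.succ
    · refine ⟨i, LinearMap.mulLeft k (e * a i.castSucc), fun x => ?_⟩
      subst h2
      funext t
      simp only [mergeDiag, Function.update_apply, ← he,
        LinearMap.mulLeft_apply, Fin.ext_iff, Fin.lt_def,
        Fin.val_castSucc, Fin.val_succ]
      split_ifs <;> first | omega | simp [mul_assoc]
    · refine ⟨i.predAbove j, LinearMap.id, fun x => ?_⟩
      funext t
      simp only [Fin.ext_iff, Fin.val_castSucc, Fin.val_succ] at h1 h2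
      simp only [mergeDiag, Function.update_apply, ← he, LinearMap.id_apply,
        Fin.predAbove, Fin.ext_iff, Fin.lt_def, Fin.val_castSucc, Fin.val_succ]
      split_ifs <;> simp_all <;> omega

theorem mergeUpper_update_of_ne {n : ℕ} (i : Fin n) (b : Pair (n + 1) → B) (r : Pair (n + 1))
    (hr : r ≠ pr i.castSucc i.succ i.castSucc_lt_succ) :
    ∃ (p : Pair n) (c : B), ∀ x,
      mergeUpper i (Function.update b r x) = Function.update (mergeUpper i b) p (x * c) := by
  have hlt : i.predAbove r.1.1 < i.predAbove r.1.2 := by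
    have h := r.2
    have hr' : ¬ ((r.1.1 : ℕ) = i ∧ (r.1.2 : ℕ) = i + 1) := fun hh =>
      hr (Subtype.ext (Prod.ext (Fin.ext hh.1) (Fin.ext hh.2)))
    simp only [Fin.predAbove, Fin.lt_def, Fin.val_castSucc] at h ⊢
    split_ifs <;> simp <;> omega
  refine ⟨pr _ _ hlt, ∏ s ∈ (Finset.univ.filter (fun s : Pair (n + 1) =>
    i.predAbove s.1.1 = i.predAbove r.1.1 ∧ i.predAbove s.1.2 = i.predAbove r.1.2)) \ {r}, b s,
    fun x => funext fun p => ?_⟩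
  by_cases hp : p = pr _ _ hlt
  · subst hp
    rw [Function.update_self]
    exact Finset.prod_update_of_mem (by simp) _ _
  · rw [Function.update_of_ne hp]
    refine Finset.prod_update_of_notMem (fun hmem => hp ?_) _ _
    simp only [Finset.mem_filter, Finset.mem_univ, true_and] at hmem
    exact Subtype.ext (Prod.ext hmem.1.symm hmem.2.symm)

theorem mergeUpper_update_self {n : ℕ} (i : Fin n) (b : Pair (n + 1) → B) (x : B) :
    mergeUpper i (Function.update b (pr i.castSucc i.succ i.castSucc_lt_succ) x) =
      mergeUpper i b := by
  funext p
  refine Finset.prod_update_of_notMem (fun hmem => ?_) _ _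
  simp only [Finset.mem_filter, Finset.mem_univ, true_and, Fin.predAbove_castSucc_self,
    Fin.predAbove_succ_self] at hmem
  exact absurd p.2 (by rw [← hmem.1, ← hmem.2]; exact lt_irrefl _)

theorem isMultilinear_merge {n : ℕ} (f : Cochain k A B n) (i : Fin n) :
    IsMultilinear k (fun (a : Fin (n + 1) → A) (b : Pair (n + 1) → B) =>
      ev f (mergeDiag ε i a b) (mergeUpper i b)) where
  left a b j := by
    obtain ⟨j', L, hL⟩ := mergeDiag_update_left ε i a b j
    obtain ⟨M, hM⟩ := (isMultilinear_ev f).left (mergeDiag ε i a b) (mergeUpper i b) j'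
    exact ⟨M ∘ₗ L, fun x => by rw [hL, hM]; rfl⟩
  right a b r := by
    by_cases hr : r = pr i.castSucc i.succ i.castSucc_lt_succ
    · subst hr
      obtain ⟨M, hM⟩ := (isMultilinear_ev f).left (mergeDiag ε i a b) (mergeUpper i b) i
      refine ⟨M ∘ₗ LinearMap.mulRight k (a i.castSucc * a i.succ) ∘ₗ ε.toLinearMap,
        fun x => ?_⟩
      rw [mergeUpper_update_self]
      have : mergeDiag ε i a (Function.update b (pr i.castSucc i.succ i.castSucc_lt_succ) x) =
          Function.update (mergeDiag ε i a b) i (ε x * (a i.castSucc * a i.succ)) := by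
        funext t
        by_cases ht : t = i
        · subst ht; simp [mergeDiag, mul_assoc]
        · simp [mergeDiag, ht]
      rw [this, hM]
      rfl
    · obtain ⟨p, c, hc⟩ := mergeUpper_update_of_ne i b r hr
      obtain ⟨M, hM⟩ := (isMultilinear_ev f).right (mergeDiag ε i a b) (mergeUpper i b) p
      refine ⟨M ∘ₗ LinearMap.mulRight k c, fun x => ?_⟩
      have : mergeDiag ε i a (Function.update b r x) = mergeDiag ε i a b := by
        funext t
        simp [mergeDiag, Function.update_of_ne (Ne.symm hr)]
      rw [this, hc, hM]
      rfl

theorem isMultilinear_dFun {n : ℕ} (f : Cochain k A B n) : IsMultilinear k (dFun ε f) :=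
  ((isMultilinear_firstTerm ε f).add
    (IsMultilinear.sum _ fun i => (isMultilinear_merge ε f i).smul _)).add
    ((isMultilinear_lastTerm ε f).smul _)

/-- The differential `δ^ε_n : C^n((A,B,ε);A) → C^{n+1}((A,B,ε);A)`. -/
def d (n : ℕ) : Cochain k A B n →ₗ[k] Cochain k A B (n + 1) where
  toFun f := mk (dFun ε f) (isMultilinear_dFun ε f)
  map_add' f g := ev_ext fun a b => by
    simp only [ev_mk, ev_add, dFun, firstTerm, lastTerm, mul_add, add_mul, smul_add,
      Finset.sum_add_distrib]
    abel
  map_smul' c f := ev_ext fun a b => by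
    simp only [ev_mk, ev_smul, dFun, firstTerm, lastTerm, smul_add, Finset.smul_sum,
      RingHom.id_apply, mul_smul_comm, smul_mul_assoc, smul_comm c]

/-- The cup product of cochains. -/
def cupC (m n : ℕ) :
    Cochain k A B m →ₗ[k] Cochain k A B n →ₗ[k] Cochain k A B (m + n) :=
  LinearMap.mk₂ k (fun f g => mk (cupFun ε f g) (isMultilinear_cupFun ε f g))
    (fun f f' g => ev_ext fun a b => by simp [cupFun, add_mul])
    (fun c f g => ev_ext fun a b => by simp [cupFun])
    (fun f g g' => ev_ext fun a b => by simp [cupFun, mul_add])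
    (fun c f g => ev_ext fun a b => by simp [cupFun])

/-- The cocycles. -/
def cocycles (n : ℕ) : Submodule k (Cochain k A B n) := LinearMap.ker (d ε n)

/-- The coboundaries (`0` in degree `0`). -/
def coboundaries : (n : ℕ) → Submodule k (Cochain k A B n)
  | 0 => ⊥
  | n + 1 => LinearMap.range (d ε n)

/-- The secondary Hochschild cohomology `H^n((A,B,ε);A)`: cocycles modulo coboundaries. -/
def Cohomology (n : ℕ) : Type _ :=
  cocycles ε n ⧸ (coboundaries ε n).submoduleOf (cocycles ε n)

instance (n : ℕ) : AddCommGroup (Cohomology ε n) :=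
  inferInstanceAs (AddCommGroup (cocycles ε n ⧸ (coboundaries ε n).submoduleOf (cocycles ε n)))

instance (n : ℕ) : Module k (Cohomology ε n) :=
  inferInstanceAs (Module k (cocycles ε n ⧸ (coboundaries ε n).submoduleOf (cocycles ε n)))

/-- The class of a cocycle. -/
def cls (n : ℕ) : cocycles ε n →ₗ[k] Cohomology ε n :=
  ((coboundaries ε n).submoduleOf (cocycles ε n)).mkQ

/-! The Leibniz rule. To avoid casts between `Fin (m + 1 + n)` and `Fin (m + n + 1)`, cochains are
evaluated on matrices with rows and columns indexed by `ℕ`, of which only a corner is used. -/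

/-- Evaluation on the upper left corner of a matrix indexed by `ℕ`. -/
def evN {n : ℕ} (f : Cochain k A B n) (a : ℕ → A) (b : ℕ → ℕ → B) : A :=
  ev f (fun i => a i) (fun p => b p.1.1 p.1.2)

theorem evN_ext {n : ℕ} {f g : Cochain k A B n} (h : ∀ a b, evN f a b = evN g a b) : f = g := by
  refine ev_ext fun a b => ?_
  have := h (fun i => if h : i < n then a ⟨i, h⟩ else 0)
    (fun i j => if h : i < j ∧ j < n then b (pr ⟨i, h.1.trans h.2⟩ ⟨j, h.2⟩ h.1) else 0)
  simp only [evN, Fin.is_lt, dite_true, Fin.eta] at this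
  convert this using 2
  all_goals
    funext p
    have h1 : (p.1.1 : ℕ) < p.1.2 := p.2
    simp [h1]

theorem evN_congr {n : ℕ} (f : Cochain k A B n) {a a' : ℕ → A} {b b' : ℕ → ℕ → B}
    (ha : ∀ i < n, a i = a' i) (hb : ∀ i j, i < j → j < n → b i j = b' i j) :
    evN f a b = evN f a' b' := by
  unfold evN
  congr 1
  · funext i; exact ha i i.2
  · funext p; exact hb _ _ p.2 p.1.2.2

/-- Merging of neighbouring entries `i` and `i + 1` of a sequence under a binary operation. -/
def mergeN {R : Type*} (op : R → R → R) (i : ℕ) (u : ℕ → R) (j : ℕ) : R :=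
  if j < i then u j else if j = i then op (u i) (u (i + 1)) else u (j + 1)

/-- Merging of neighbouring rows and columns above the diagonal. -/
def mergeN₂ (i : ℕ) (b : ℕ → ℕ → B) (p q : ℕ) : B :=
  mergeN (· * ·) i (fun p' => mergeN (· * ·) i (b p') q) p

theorem mergeUpper_nat {n : ℕ} (i : Fin n) (b : ℕ → ℕ → B) (p : Pair n) :
    mergeUpper i (fun r => b r.1.1 r.1.2) p = mergeN₂ i b p.1.1 p.1.2 := by
  obtain ⟨⟨p, q⟩, h⟩ := p
  have hpq : (p : ℕ) < q := h
  have hval : ∀ r : Fin (n + 1), ∀ t : Fin n, i.predAbove r = t ↔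
      ((r : ℕ) ≤ i ∧ (r : ℕ) = t) ∨ ((i : ℕ) < r ∧ (r : ℕ) = t + 1) := by
    intro r t
    simp only [Fin.predAbove, Fin.lt_def, Fin.ext_iff, Fin.val_castSucc]
    split_ifs <;> simp <;> omega
  have one : ∀ (P Q : Fin (n + 1)) (hPQ : P < Q),
      (∀ r : Pair (n + 1), (i.predAbove r.1.1 = p ∧ i.predAbove r.1.2 = q) ↔
        ((r.1.1 : ℕ) = P ∧ (r.1.2 : ℕ) = Q)) →
      mergeUpper i (fun r => b r.1.1 r.1.2) ⟨(p, q), h⟩ = b P Q := by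
    intro P Q hPQ hr
    unfold mergeUpper
    rw [Finset.prod_eq_single (pr P Q hPQ)]
    · intro r hmem hne
      refine absurd (Subtype.ext (Prod.ext (Fin.ext ?_) (Fin.ext ?_))) hne
      · exact ((hr r).1 (by simpa using hmem)).1
      · exact ((hr r).1 (by simpa using hmem)).2
    · intro hmem
      exact absurd ((hr (pr P Q hPQ)).2 ⟨rfl, rfl⟩) (by simpa using hmem)
  have two : ∀ (P Q P' Q' : Fin (n + 1)) (hPQ : P < Q) (hPQ' : P' < Q')
      (_ : pr P Q hPQ ≠ pr P' Q' hPQ'),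
      (∀ r : Pair (n + 1), (i.predAbove r.1.1 = p ∧ i.predAbove r.1.2 = q) ↔
        (((r.1.1 : ℕ) = P ∧ (r.1.2 : ℕ) = Q) ∨ ((r.1.1 : ℕ) = P' ∧ (r.1.2 : ℕ) = Q'))) →
      mergeUpper i (fun r => b r.1.1 r.1.2) ⟨(p, q), h⟩ = b P Q * b P' Q' := by
    intro P Q P' Q' hPQ hPQ' hne hr
    unfold mergeUpper
    have : (Finset.univ.filter fun r : Pair (n + 1) =>
        i.predAbove r.1.1 = p ∧ i.predAbove r.1.2 = q) = {pr P Q hPQ, pr P' Q' hPQ'} := by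
      ext r
      simp only [Finset.mem_filter, Finset.mem_univ, true_and, Finset.mem_insert,
        Finset.mem_singleton, hr]
      simp only [Subtype.ext_iff, Prod.ext_iff, Fin.ext_iff]
    rw [this, Finset.prod_pair hne]
  simp only [hval] at one two
  simp only [mergeN₂, mergeN]
  rcases lt_trichotomy (q : ℕ) i with hq | hq | hq
  · rw [one p.castSucc q.castSucc h (by intro r; simp; omega)]
    simp [hq, hpq.trans hq]
  · rw [two p.castSucc q.castSucc p.castSucc q.succ h (by rw [Fin.lt_def]; simp; omega)
      (by simp [Fin.ext_iff]) (by intro r; simp; omega)]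
    simp [hq, show (p : ℕ) < i by omega]
  · have hq1 : ¬ (q : ℕ) < i := by omega
    have hq2 : ¬ (q : ℕ) = i := by omega
    rcases lt_trichotomy (p : ℕ) i with hp | hp | hp
    · rw [one p.castSucc q.succ (by rw [Fin.lt_def]; simp; omega) (by intro r; simp; omega)]
      simp [hq1, hq2, hp]
    · rw [two p.castSucc q.succ p.succ q.succ (by rw [Fin.lt_def]; simp; omega)
        (by rw [Fin.lt_def]; simp; omega) (by simp [Fin.ext_iff]) (by intro r; simp; omega)]
      simp [hq1, hq2, hp]
    · rw [one p.succ q.succ (by rw [Fin.lt_def]; simp; omega) (by intro r; simp; omega)]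
      simp [hq1, hq2, show ¬ (p : ℕ) < i by omega, show ¬ (p : ℕ) = i by omega]

theorem evN_d {n : ℕ} (f : Cochain k A B n) (a : ℕ → A) (b : ℕ → ℕ → B) :
    evN (d ε n f) a b =
      a 0 * ε (∏ j ∈ Finset.range n, b 0 (j + 1)) *
        evN f (fun i => a (i + 1)) (fun i j => b (i + 1) (j + 1))
      + ∑ i ∈ Finset.range n, (-1 : k) ^ (i + 1) •
          evN f (mergeN (fun x y => ε (b i (i + 1)) * x * y) i a) (mergeN₂ i b)
      + (-1 : k) ^ (n + 1) • (evN f a b * a n * ε (∏ i ∈ Finset.range n, b i n)) := by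
  simp only [Finset.prod_range, Finset.sum_range]
  have : ∀ i : Fin n, mergeDiag ε i (fun j => a j) (fun r => b r.1.1 r.1.2) =
      fun j : Fin n => mergeN (fun x y => ε (b i (i + 1)) * x * y) i a j := by
    intro i
    funext j
    simp only [mergeDiag, mergeN, Fin.lt_def, Fin.ext_iff, Fin.val_castSucc, Fin.val_succ]
  simp only [evN, d, LinearMap.coe_mk, AddHom.coe_mk, ev_mk, dFun, this]
  have h2 : ∀ i : Fin n, mergeUpper i (fun r => b r.1.1 r.1.2) =
      fun p => mergeN₂ i b p.1.1 p.1.2 := fun i => funext fun p => mergeUpper_nat i b p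
  simp only [h2]
  rfl

theorem evN_cup {m n : ℕ} (f : Cochain k A B m) (g : Cochain k A B n) (a : ℕ → A)
    (b : ℕ → ℕ → B) :
    evN (cupC ε m n f g) a b =
      evN f a b * ε (∏ i ∈ Finset.range m, ∏ j ∈ Finset.range n, b i (m + j)) *
        evN g (fun i => a (m + i)) (fun i j => b (m + i) (m + j)) := by
  simp only [Finset.prod_range]
  rw [← Fintype.prod_prod_type' (f := fun (i : Fin m) (j : Fin n) => b i (m + j))]
  simp only [cupC, LinearMap.mk₂_apply, evN, ev_mk]
  rfl

theorem prod_mergeN_of_lt {i m : ℕ} (u : ℕ → B) (h : i < m) :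
    ∏ p ∈ Finset.range m, mergeN (· * ·) i u p = ∏ p ∈ Finset.range (m + 1), u p := by
  obtain ⟨l, rfl⟩ : ∃ l, m = i + 1 + l := ⟨m - (i + 1), by omega⟩
  rw [Finset.prod_range_add, show i + 1 + l + 1 = i + 1 + 1 + l by omega,
    Finset.prod_range_add u,
    Finset.prod_range_succ, Finset.prod_range_succ u (i + 1), Finset.prod_range_succ u i]
  congr 1
  · rw [mul_assoc]
    congr 1
    · exact Finset.prod_congr rfl fun p hp => by simp [mergeN, Finset.mem_range.1 hp]
    · simp [mergeN]
  · refine Finset.prod_congr rfl fun p _ => ?_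
    simp only [mergeN]
    rw [if_neg (by omega), if_neg (by omega)]
    congr 1
    omega

theorem mergeN_of_lt {R : Type*} (op : R → R → R) {i j : ℕ} (u : ℕ → R) (h : j < i) :
    mergeN op i u j = u j := if_pos h

theorem mergeN_of_gt {R : Type*} (op : R → R → R) {i j : ℕ} (u : ℕ → R) (h : i < j) :
    mergeN op i u j = u (j + 1) := by
  rw [mergeN, if_neg (by omega), if_neg (by omega)]

theorem mergeN_add {R : Type*} (op : R → R → R) (m i j : ℕ) (u : ℕ → R) :
    mergeN op (m + i) u (m + j) = mergeN op i (fun t => u (m + t)) j := by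
  simp [mergeN, add_assoc]

theorem leibniz (hε : ∀ x, ε x ∈ Subalgebra.center k A) {m n : ℕ} (f : Cochain k A B m)
    (g : Cochain k A B n) (a : ℕ → A) (b : ℕ → ℕ → B) :
    evN (d ε (m + n) (cupC ε m n f g)) a b =
      evN (cupC ε (m + 1) n (d ε m f) g) a b +
        (-1 : k) ^ m • evN (cupC ε m (n + 1) f (d ε n g)) a b := by
  have comm : ∀ (x : B) (y : A), y * ε x = ε x * y := fun x y =>
    Subalgebra.mem_center_iff.1 (hε x) y
  have L1 : ∀ (x y : B) (p q r : A), p * ε x * (q * ε y * r) = ε (x * y) * (p * q * r) := by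
    intro x y p q r
    rw [comm x p, comm y q, map_mul, mul_assoc, mul_assoc, mul_assoc, ← mul_assoc p, comm y p]
    simp only [mul_assoc]
  have L2 : ∀ (x y : B) (p q r : A), p * ε x * q * ε y * r = ε (x * y) * (p * q * r) := by
    intro x y p q r
    rw [← L1]
    simp only [mul_assoc]
  set P := ∏ i ∈ Finset.range (m + 1), ∏ j ∈ Finset.range n, b i (m + 1 + j) with hP
  set Q := ∏ i ∈ Finset.range m, ∏ j ∈ Finset.range (n + 1), b i (m + j) with hQ
  set G := evN g (fun i => a (m + 1 + i)) (fun i j => b (m + 1 + i) (m + 1 + j)) with hG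
  have hG' : evN g (fun i => a (m + (i + 1))) (fun i j => b (m + (i + 1)) (m + (j + 1))) = G := by
    simp only [hG, add_assoc, add_comm 1]
  have hG'' : evN g (fun i => a (m + i + 1)) (fun i j => b (m + i + 1) (m + j + 1)) = G := hG'
  -- the first term
  have T1 : a 0 * ε (∏ j ∈ Finset.range (m + n), b 0 (j + 1)) *
      evN (cupC ε m n f g) (fun i => a (i + 1)) (fun i j => b (i + 1) (j + 1)) =
      a 0 * ε (∏ j ∈ Finset.range m, b 0 (j + 1)) *
        evN f (fun i => a (i + 1)) (fun i j => b (i + 1) (j + 1)) * ε P * G := by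
    rw [evN_cup, hG'']
    have : (∏ j ∈ Finset.range (m + n), b 0 (j + 1)) *
        (∏ i ∈ Finset.range m, ∏ j ∈ Finset.range n, b (i + 1) (m + j + 1)) =
        (∏ j ∈ Finset.range m, b 0 (j + 1)) * P := by
      rw [hP, Finset.prod_range_succ', Finset.prod_range_add]
      simp only [show ∀ j, m + 1 + j = m + j + 1 from fun j => by omega]
      ring
    rw [L1, L2, this]
  -- merging inside the first block
  have T2 : ∀ i ∈ Finset.range m,
      evN (cupC ε m n f g) (mergeN (fun x y => ε (b i (i + 1)) * x * y) i a) (mergeN₂ i b) =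
      evN f (mergeN (fun x y => ε (b i (i + 1)) * x * y) i a) (mergeN₂ i b) * ε P * G := by
    intro i hi
    have hi := Finset.mem_range.1 hi
    rw [evN_cup]
    rw [← hG'']
    congr 1
    · congr 2
      rw [hP, Finset.prod_comm, Finset.prod_comm (s := Finset.range (m + 1))]
      refine Finset.prod_congr rfl fun q _ => ?_
      simp only [mergeN₂]
      rw [prod_mergeN_of_lt _ hi]
      refine Finset.prod_congr rfl fun p _ => ?_
      rw [mergeN_of_gt _ _ (by omega), add_right_comm]
    · refine evN_congr g (fun t _ => mergeN_of_gt _ _ (by omega)) fun p q _ _ => ?_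
      simp only [mergeN₂]
      rw [mergeN_of_gt _ _ (by omega), mergeN_of_gt _ _ (by omega)]
  -- merging inside the second block
  have T3 : ∀ i ∈ Finset.range n,
      evN (cupC ε m n f g) (mergeN (fun x y => ε (b (m + i) (m + i + 1)) * x * y) (m + i) a)
        (mergeN₂ (m + i) b) =
      evN f a b * ε Q * evN g (mergeN (fun x y => ε (b (m + i) (m + (i + 1))) * x * y) i
        (fun t => a (m + t))) (mergeN₂ i (fun p q => b (m + p) (m + q))) := by
    intro i hi
    have hi := Finset.mem_range.1 hi
    rw [evN_cup]
    congr 2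
    · refine evN_congr f (fun t _ => mergeN_of_lt _ _ (by omega)) fun p q _ _ => ?_
      simp only [mergeN₂]
      rw [mergeN_of_lt _ _ (by omega), mergeN_of_lt _ _ (by omega)]
    · congr 1
      refine Finset.prod_congr rfl fun p hp => ?_
      have hp := Finset.mem_range.1 hp
      rw [← prod_mergeN_of_lt (fun j => b p (m + j)) hi]
      refine Finset.prod_congr rfl fun q _ => ?_
      simp only [mergeN₂]
      rw [mergeN_of_lt _ _ (by omega), mergeN_add]
    · funext t
      rw [mergeN_add]
      rfl
    · funext p q
      simp only [mergeN₂, mergeN_add]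
  -- the last term
  have T4 : evN (cupC ε m n f g) a b * a (m + n) * ε (∏ i ∈ Finset.range (m + n), b i (m + n)) =
      evN f a b * ε Q * (evN g (fun i => a (m + i)) (fun i j => b (m + i) (m + j)) * a (m + n) *
        ε (∏ i ∈ Finset.range n, b (m + i) (m + n))) := by
    rw [evN_cup]
    have : (∏ i ∈ Finset.range (m + n), b i (m + n)) *
        (∏ i ∈ Finset.range m, ∏ j ∈ Finset.range n, b i (m + j)) =
        (∏ i ∈ Finset.range n, b (m + i) (m + n)) * Q := by
      simp only [hQ, Finset.prod_range_succ, Finset.prod_mul_distrib, Finset.prod_range_add]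
      ring
    have h1 := L2 (∏ i ∈ Finset.range m, ∏ j ∈ Finset.range n, b i (m + j))
      (∏ i ∈ Finset.range (m + n), b i (m + n)) (evN f a b)
      (evN g (fun i => a (m + i)) (fun i j => b (m + i) (m + j)) * a (m + n)) 1
    have h2 := L1 Q (∏ i ∈ Finset.range n, b (m + i) (m + n)) (evN f a b)
      (evN g (fun i => a (m + i)) (fun i j => b (m + i) (m + j)) * a (m + n)) 1
    rw [mul_comm, this, mul_comm, ← h2] at h1
    simpa only [mul_assoc, mul_one] using h1
  -- the two terms that cancel
  have T5 : evN f a b * a m * ε (∏ i ∈ Finset.range m, b i m) * ε P * G =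
      evN f a b * ε Q * (a m * ε (∏ j ∈ Finset.range n, b m (m + (j + 1))) * G) := by
    have : (∏ i ∈ Finset.range m, b i m) * P =
        (∏ j ∈ Finset.range n, b m (m + (j + 1))) * Q := by
      simp only [hP, hQ, Finset.prod_range_succ', Finset.prod_range_succ _ m,
        Finset.prod_mul_distrib, add_zero]
      simp only [show ∀ j, m + 1 + j = m + (j + 1) from fun j => by omega]
      ring
    have h1 := L2 (∏ i ∈ Finset.range m, b i m) P (evN f a b * a m) 1 G
    rw [mul_one, mul_one] at h1
    rw [h1, L1, this, mul_comm Q]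
  rw [evN_d, evN_cup ε (d ε m f), evN_cup ε f (d ε n g), evN_d, evN_d, T1, T4,
    Finset.sum_range_add, Finset.sum_congr rfl fun i hi => congrArg _ (T2 i hi),
    Finset.sum_congr rfl fun i hi => congrArg (fun z => (-1 : k) ^ (m + i + 1) • z) (T3 i hi)]
  rw [hG']
  simp only [add_mul, mul_add, smul_add, Finset.sum_mul, Finset.mul_sum, Finset.smul_sum,
    smul_mul_assoc, mul_smul_comm, smul_smul, ← pow_add, add_zero]
  rw [← hP, ← hQ, ← hG, T5]
  rw [show (-1 : k) ^ (m + 1) = - (-1 : k) ^ m by ring, neg_smul]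
  simp only [← add_assoc]
  abel

theorem evN_zero {n : ℕ} (a b) : evN (0 : Cochain k A B n) a b = 0 := rfl

theorem evN_add {n : ℕ} (f g : Cochain k A B n) (a b) :
    evN (f + g) a b = evN f a b + evN g a b := rfl

theorem evN_smul {n : ℕ} (c : k) (f : Cochain k A B n) (a b) :
    evN (c • f) a b = c • evN f a b := rfl

theorem mem_coboundaries_of_evN {N M : ℕ} (h : M + 1 = N) (y : Cochain k A B M)
    (x : Cochain k A B N) (hxy : ∀ a b, evN (d ε M y) a b = evN x a b) :
    x ∈ coboundaries ε N := by
  subst h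
  exact ⟨y, evN_ext hxy⟩

theorem cupC_mem_cocycles (hε : ∀ x, ε x ∈ Subalgebra.center k A) {m n : ℕ}
    {f : Cochain k A B m} {g : Cochain k A B n} (hf : f ∈ cocycles ε m)
    (hg : g ∈ cocycles ε n) : cupC ε m n f g ∈ cocycles ε (m + n) := by
  refine LinearMap.mem_ker.2 (evN_ext fun a b => ?_)
  rw [leibniz ε hε, LinearMap.mem_ker.1 hf, LinearMap.mem_ker.1 hg]
  simp [evN_zero]

theorem cupC_mem_coboundaries_left (hε : ∀ x, ε x ∈ Subalgebra.center k A) {m n : ℕ}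
    {f : Cochain k A B m} {g : Cochain k A B n} (hf : f ∈ coboundaries ε m)
    (hg : g ∈ cocycles ε n) : cupC ε m n f g ∈ coboundaries ε (m + n) := by
  cases m with
  | zero =>
    obtain rfl : f = 0 := hf
    simp
  | succ m =>
    obtain ⟨h, rfl⟩ := hf
    refine mem_coboundaries_of_evN ε (by omega) (cupC ε m n h g) _ fun a b => ?_
    rw [leibniz ε hε, LinearMap.mem_ker.1 hg]
    simp [evN_zero]

theorem cupC_mem_coboundaries_right (hε : ∀ x, ε x ∈ Subalgebra.center k A) {m n : ℕ}
    {f : Cochain k A B m} {g : Cochain k A B n} (hf : f ∈ cocycles ε m)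
    (hg : g ∈ coboundaries ε n) : cupC ε m n f g ∈ coboundaries ε (m + n) := by
  cases n with
  | zero =>
    obtain rfl : g = 0 := hg
    simp
  | succ n =>
    obtain ⟨h, rfl⟩ := hg
    refine mem_coboundaries_of_evN ε (by omega) ((-1 : k) ^ m • cupC ε m n f h) _ fun a b => ?_
    rw [map_smul, evN_smul, leibniz ε hε, LinearMap.mem_ker.1 hf]
    simp [evN_zero, smul_smul, ← mul_pow]

/-- The cup product of cocycles. -/
def cupZ (hε : ∀ x, ε x ∈ Subalgebra.center k A) (m n : ℕ) :
    cocycles ε m →ₗ[k] cocycles ε n →ₗ[k] cocycles ε (m + n) :=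
  LinearMap.mk₂ k (fun f g => ⟨cupC ε m n f g, cupC_mem_cocycles ε hε f.2 g.2⟩)
    (fun _ _ _ => Subtype.ext (by simp)) (fun _ _ _ => Subtype.ext (by simp))
    (fun _ _ _ => Subtype.ext (by simp)) (fun _ _ _ => Subtype.ext (by simp))

/-- The cup product `H^m((A,B,ε);A) × H^n((A,B,ε);A) → H^{m+n}((A,B,ε);A)`,
`[f] ⌣ [g] = [f ⌣ g]`. -/
def cupH (hε : ∀ x, ε x ∈ Subalgebra.center k A) (m n : ℕ) :
    Cohomology ε m →ₗ[k] Cohomology ε n →ₗ[k] Cohomology ε (m + n) :=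
  Submodule.liftQ _
    { toFun := fun f => Submodule.liftQ _ (cls ε (m + n) ∘ₗ cupZ ε hε m n f) (fun g hg =>
        LinearMap.mem_ker.2 ((Submodule.Quotient.mk_eq_zero _).2
          (cupC_mem_coboundaries_right ε hε f.2 hg)))
      map_add' := fun f f' => Submodule.linearMap_qext _ (by ext g; simp; rfl)
      map_smul' := fun c f => Submodule.linearMap_qext _ (by ext g; simp; rfl) }
    (fun f hf => LinearMap.mem_ker.2 (Submodule.linearMap_qext _ (LinearMap.ext fun g =>
      (Submodule.Quotient.mk_eq_zero _).2 (cupC_mem_coboundaries_left ε hε hf g.2))))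

theorem cupH_cls (hε : ∀ x, ε x ∈ Subalgebra.center k A) (m n : ℕ) (f : cocycles ε m)
    (g : cocycles ε n) :
    cupH ε hε m n (cls ε m f) (cls ε n g) =
      cls ε (m + n) ⟨cupC ε m n f g, cupC_mem_cocycles ε hε f.2 g.2⟩ := rfl

/-- The total cohomology `H^*((A,B,ε);A)`. -/
abbrev TotalCohomology : Type _ := ⨁ n, Cohomology ε n

/-- The cup product on `H^*((A,B,ε);A)`, the bilinear extension of the cup products of
homogeneous classes. -/
def cup (hε : ∀ x, ε x ∈ Subalgebra.center k A) :
    TotalCohomology ε →ₗ[k] TotalCohomology ε →ₗ[k] TotalCohomology ε :=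
  DirectSum.toModule k ℕ _ fun m => LinearMap.flip <| DirectSum.toModule k ℕ _ fun n =>
    LinearMap.flip <| (cupH ε hε m n).compr₂ (DirectSum.lof k ℕ (Cohomology ε) (m + n))

theorem cup_lof (hε : ∀ x, ε x ∈ Subalgebra.center k A) (m n : ℕ) (x : Cohomology ε m)
    (y : Cohomology ε n) :
    cup ε hε (DirectSum.lof k ℕ (Cohomology ε) m x) (DirectSum.lof k ℕ (Cohomology ε) n y) =
      DirectSum.lof k ℕ (Cohomology ε) (m + n) (cupH ε hε m n x y) := by
  simp [cup]

end Complex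

end SecondaryHochschild

end

/-! The homotopy is Gerstenhaber's, adapted to matrices. For a cochain `f` of degree m and `g` of
degree l+1, the insertion f ∘ᵢ g (0 ≤ i < m) takes a matrix of size m+l, replaces the diagonal block
of size l+1 at i by the single entry g(block), multiplies together the entries of `B` in the rows
and columns that collapse, and applies `f`. Each f ∘ᵢ g is again a cochain (`exists_insertion`).

Let T have size m+l+1, let Tᵢ (0 ≤ i ≤ m) be the matrix of size m+1 obtained by inserting `g` at i,
and let Uᵢ be the alternating sum of the cofaces 0, …, i of `f` on Tᵢ (`partialSum`). In d(f ∘ᵢ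
g)(T) the cofaces to the left of the block are cofaces of `f` on Tᵢ₊₁, those to the right are
cofaces of `f` on Tᵢ, and those inside are the inner cofaces of `g` on a block of size l+2. The
cocycle identity of `g` trades the inner cofaces for its two outer ones, which are the coface i+1 of
`f` on Tᵢ₊₁ and on Tᵢ. The cocycle identity of `f` on Tᵢ trades the right-hand cofaces for left-hand
ones. What remains is Uᵢ₊₁ − (-1)^l Uᵢ (`d_insertion`).

With weights (-1)^(li) these differences telescope to the ends: U₀ is (g ⌣ f)(T), and Uₘ is (-1)^m
(f ⌣ g)(T), because the cocycle identity of `f` leaves only the last coface. This gives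
`exists_homotopy`.

Centrality of the image of `ε` lets scalars from `B` move past elements of `A`. Commutativity of `B`
makes products over rectangles compose, so that every identity between upper parts becomes an
identity between monotone maps of cut points. Insertion needs `g` of positive degree; exchanging the
factors leaves only bidegree (0,0), where a cocycle is a central element of `A`. -/

noncomputable section

namespace SecondaryHochschild

/-! ### Products over intervals and rectangles -/

section Merging

variable {B : Type*} [CommRing B]

/-- The cut points of the partition of `ℕ` into the block `{i, …, i + l}` and singletons: the
`p`-th part is the interval from `cut i l p` to `cut i l (p + 1)`. -/
def cut (i l p : ℕ) : ℕ := if p ≤ i then p else p + l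

theorem cut_of_le {i l p : ℕ} (h : p ≤ i) : cut i l p = p := if_pos h

theorem cut_of_gt {i l p : ℕ} (h : i < p) : cut i l p = p + l := if_neg (by omega)

theorem monotone_cut (i l : ℕ) : Monotone (cut i l) := by
  intro p q h
  unfold cut
  split_ifs <;> omega

/-- The products of a sequence over the intervals with cut points `c`. -/
def mg (c : ℕ → ℕ) (u : ℕ → B) (p : ℕ) : B := ∏ r ∈ Finset.Ico (c p) (c (p + 1)), u r

/-- The products of the entries of a matrix over the rectangles with cut points `c`. -/
def mg₂ (c : ℕ → ℕ) (b : ℕ → ℕ → B) (p q : ℕ) : B := mg c (fun r => mg c (b r) q) p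

/-- Consecutive intervals are glued one at a time; monotonicity of `c` keeps them adjacent and
disjoint. -/
theorem prod_Ico_mg {c : ℕ → ℕ} (hc : Monotone c) (u : ℕ → B) {s t : ℕ} (h : s ≤ t) :
    ∏ p ∈ Finset.Ico s t, mg c u p = ∏ r ∈ Finset.Ico (c s) (c t), u r := by
  induction t, h using Nat.le_induction with
  | base => simp
  | succ t h ih =>
    rw [Finset.prod_Ico_succ_top h, ih, mg,
      Finset.prod_Ico_consecutive _ (hc h) (hc (Nat.le_succ t))]

theorem mg_mg {c c' : ℕ → ℕ} (hc : Monotone c) (hc' : Monotone c') (u : ℕ → B) :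
    mg c' (mg c u) = mg (fun p => c (c' p)) u :=
  funext fun p => prod_Ico_mg hc u (hc' (Nat.le_succ p))

theorem mg_prod {ι : Type*} (c : ℕ → ℕ) (s : Finset ι) (u : ℕ → ι → B) (p : ℕ) :
    mg c (fun r => ∏ t ∈ s, u r t) p = ∏ t ∈ s, mg c (fun r => u r t) p :=
  Finset.prod_comm

/-- A rectangle of rectangles is a rectangle. Since merging, inserting and shifting are all of the
form `mg₂`, any composite of them is described by one composed cut map. -/
theorem mg₂_mg₂ {c c' : ℕ → ℕ} (hc : Monotone c) (hc' : Monotone c') (b : ℕ → ℕ → B) :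
    mg₂ c' (mg₂ c b) = mg₂ (fun p => c (c' p)) b := by
  funext p q
  simp only [mg₂]
  rw [← mg_mg hc hc' (fun r => mg _ (b r) q)]
  congr 1
  funext p'
  have : ∀ r, mg (fun p => c (c' p)) (b r) q = mg c' (mg c (b r)) q := fun r => by
    rw [mg_mg hc hc']
  simp only [this]
  exact (mg_prod c _ _ _).symm

theorem mg_congr_cut {c c' : ℕ → ℕ} (u : ℕ → B) {p p' : ℕ} (h : c p = c' p')
    (h' : c (p + 1) = c' (p' + 1)) : mg c u p = mg c' u p' := by
  rw [mg, mg, h, h']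

/-- Only four cut points matter for one entry, so comparing two composites of mergings is a case
split on inequalities between indices. -/
theorem mg₂_congr_cut {c c' : ℕ → ℕ} (b : ℕ → ℕ → B) {p q p' q' : ℕ} (hp : c p = c' p')
    (hp' : c (p + 1) = c' (p' + 1)) (hq : c q = c' q') (hq' : c (q + 1) = c' (q' + 1)) :
    mg₂ c b p q = mg₂ c' b p' q' := by
  unfold mg₂
  rw [mg_congr_cut _ hp hp']
  congr 1
  funext r
  exact mg_congr_cut _ hq hq'

/-- A shift has intervals of length one, so taking the lower right submatrix is also an instance of
`mg₂`. -/
theorem mg₂_add (s : ℕ) (b : ℕ → ℕ → B) :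
    mg₂ (fun p => s + p) b = fun p q => b (s + p) (s + q) := by
  funext p q
  simp [mg₂, mg, ← add_assoc]

theorem mg₂_id (b : ℕ → ℕ → B) : mg₂ (fun p => p) b = b := by
  funext p q
  simp [mg₂, mg]

theorem monotone_add (s : ℕ) : Monotone fun p : ℕ => s + p := fun _ _ h => Nat.add_le_add_left h s

theorem mg₂_shift {c : ℕ → ℕ} (hc : Monotone c) (s : ℕ) (b : ℕ → ℕ → B) :
    (fun p q => mg₂ c b (s + p) (s + q)) = mg₂ (fun p => c (s + p)) b := by
  rw [← mg₂_mg₂ hc (monotone_add s), mg₂_add]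

theorem shift_mg₂ {c : ℕ → ℕ} (hc : Monotone c) (s : ℕ) (b : ℕ → ℕ → B) :
    mg₂ c (fun p q => b (s + p) (s + q)) = mg₂ (fun p => s + c p) b := by
  rw [← mg₂_mg₂ (monotone_add s) hc, mg₂_add]

theorem mergeN_mul (i : ℕ) (u : ℕ → B) : mergeN (· * ·) i u = mg (cut i 1) u := by
  funext p
  rcases lt_trichotomy p i with h | rfl | h
  · rw [mergeN_of_lt _ _ h, mg, cut_of_le h.le, cut_of_le h]
    simp
  · rw [mg, cut_of_le le_rfl, cut_of_gt (Nat.lt_succ_self p),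
      Finset.prod_Ico_succ_top (by omega)]
    simp [mergeN]
  · rw [mergeN_of_gt _ _ h, mg, cut_of_gt h, cut_of_gt (by omega)]
    simp

theorem mergeN₂_eq (i : ℕ) (b : ℕ → ℕ → B) : mergeN₂ i b = mg₂ (cut i 1) b := by
  funext p q
  simp only [mergeN₂, mg₂, mergeN_mul]

/-- For `p < q` the interval of rows ends no later than the interval of columns begins, so the
rectangle lies strictly above the diagonal. Rectangles with `p = q` do reach the diagonal and below,
but cochains never read them. -/
theorem mg₂_congr {c : ℕ → ℕ} (hc : Monotone c) {b b' : ℕ → ℕ → B} {p q N : ℕ} (hpq : p < q)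
    (hq : c (q + 1) ≤ N) (h : ∀ r s, r < s → s < N → b r s = b' r s) :
    mg₂ c b p q = mg₂ c b' p q := by
  unfold mg₂ mg
  refine Finset.prod_congr rfl fun r hr => Finset.prod_congr rfl fun s hs => ?_
  rw [Finset.mem_Ico] at hr hs
  exact h r s (by have := hc (show p + 1 ≤ q from hpq); omega) (by omega)

theorem prod_mg₂_left {c : ℕ → ℕ} (hc : Monotone c) (b : ℕ → ℕ → B) {s t : ℕ} (h : s ≤ t)
    (q : ℕ) : ∏ p ∈ Finset.Ico s t, mg₂ c b p q =
      ∏ r ∈ Finset.Ico (c s) (c t), ∏ r' ∈ Finset.Ico (c q) (c (q + 1)), b r r' :=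
  prod_Ico_mg hc _ h

theorem prod_mg₂_right {c : ℕ → ℕ} (hc : Monotone c) (b : ℕ → ℕ → B) {s t : ℕ} (h : s ≤ t)
    (p : ℕ) : ∏ q ∈ Finset.Ico s t, mg₂ c b p q =
      ∏ r ∈ Finset.Ico (c p) (c (p + 1)), ∏ r' ∈ Finset.Ico (c s) (c t), b r r' := by
  simp only [mg₂]
  rw [← mg_prod]
  exact Finset.prod_congr rfl fun r _ => prod_Ico_mg hc _ h

/-- The sequence `a` with the entries `i, …, i + l` replaced by the single entry `z`. -/
def insA {R : Type*} (i l : ℕ) (z : R) (a : ℕ → R) (j : ℕ) : R :=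
  if j < i then a j else if j = i then z else a (j + l)

theorem insA_of_lt {R : Type*} {i l j : ℕ} (z : R) (a : ℕ → R) (h : j < i) :
    insA i l z a j = a j := if_pos h

theorem insA_self {R : Type*} (i l : ℕ) (z : R) (a : ℕ → R) : insA i l z a i = z := by
  simp [insA]

theorem insA_of_gt {R : Type*} {i l j : ℕ} (z : R) (a : ℕ → R) (h : i < j) :
    insA i l z a j = a (j + l) := by
  rw [insA, if_neg (by omega), if_neg (by omega)]

end Merging

/-! ### The differential as an alternating sum of cofaces -/

section Cofaces

variable {k A B : Type*} [CommRing k] [Ring A] [Algebra k A] [CommRing B] [Algebra k B]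
  (ε : B →ₐ[k] A)

/-- The term of the differential in which the rows and columns `i` and `i + 1` are merged. -/
def mergeFace {m : ℕ} (f : Cochain k A B m) (i : ℕ) (a : ℕ → A) (b : ℕ → ℕ → B) : A :=
  evN f (insA i 1 (ε (b i (i + 1)) * a i * a (i + 1)) a) (mg₂ (cut i 1) b)

/-- The cofaces, whose alternating sum is the differential. -/
def face {m : ℕ} (f : Cochain k A B m) (a : ℕ → A) (b : ℕ → ℕ → B) : ℕ → A
  | 0 => a 0 * ε (∏ j ∈ Finset.Ico 1 (m + 1), b 0 j) *
      evN f (fun t => a (1 + t)) (fun p q => b (1 + p) (1 + q))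
  | i + 1 => if i < m then mergeFace ε f i a b else
      evN f a b * a m * ε (∏ i ∈ Finset.Ico 0 m, b i m)

theorem face_zero {m : ℕ} (f : Cochain k A B m) (a : ℕ → A) (b : ℕ → ℕ → B) :
    face ε f a b 0 = a 0 * ε (∏ j ∈ Finset.Ico 1 (m + 1), b 0 j) *
      evN f (fun t => a (1 + t)) (fun p q => b (1 + p) (1 + q)) := rfl

theorem face_succ {m i : ℕ} (f : Cochain k A B m) (a : ℕ → A) (b : ℕ → ℕ → B) (h : i < m) :
    face ε f a b (i + 1) = mergeFace ε f i a b := if_pos h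

theorem face_last {m : ℕ} (f : Cochain k A B m) (a : ℕ → A) (b : ℕ → ℕ → B) :
    face ε f a b (m + 1) = evN f a b * a m * ε (∏ i ∈ Finset.Ico 0 m, b i m) :=
  if_neg (lt_irrefl m)

/-- Puts the first, merging and last terms under one sign rule, so that the sum can later be cut at
any index. -/
theorem evN_d_eq_sum_face {m : ℕ} (f : Cochain k A B m) (a : ℕ → A) (b : ℕ → ℕ → B) :
    evN (d ε m f) a b = ∑ j ∈ Finset.range (m + 2), (-1 : k) ^ j • face ε f a b j := by
  rw [evN_d, Finset.sum_range_succ, Finset.sum_range_succ', face_last, face_zero, pow_zero,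
    one_smul, add_comm (Finset.sum _ _) (a 0 * _ * _)]
  congr 2
  · rw [Finset.prod_Ico_eq_prod_range]
    simp only [Nat.add_sub_cancel, add_comm 1]
  · refine Finset.sum_congr rfl fun i hi => ?_
    rw [face_succ ε f a b (Finset.mem_range.1 hi), mergeN₂_eq]
    rfl
  · rw [Finset.range_eq_Ico]

theorem sum_face_eq_zero {m : ℕ} {f : Cochain k A B m} (hf : f ∈ cocycles ε m) (a : ℕ → A)
    (b : ℕ → ℕ → B) : ∑ j ∈ Finset.range (m + 2), (-1 : k) ^ j • face ε f a b j = 0 := by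
  rw [← evN_d_eq_sum_face, LinearMap.mem_ker.1 hf, evN_zero]

end Cofaces

/-! ### Cochains from multilinear functions of matrices indexed by `ℕ` -/

section Multilinear

variable {k A B : Type*} [CommRing k] [Ring A] [Algebra k A] [CommRing B] [Algebra k B]

/-- Replacement of the entry `(r, s)` of a matrix. -/
def upd₂ (b : ℕ → ℕ → B) (r s : ℕ) (x : B) (p q : ℕ) : B := if p = r ∧ q = s then x else b p q

theorem evN_update_left {m : ℕ} (f : Cochain k A B m) (a : ℕ → A) (b : ℕ → ℕ → B) {i : ℕ}
    (hi : i < m) : ∃ L : A →ₗ[k] A, ∀ x, evN f (Function.update a i x) b = L x := by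
  obtain ⟨L, hL⟩ := (isMultilinear_ev f).left (fun i => a i) (fun p => b p.1.1 p.1.2) ⟨i, hi⟩
  refine ⟨L, fun x => ?_⟩
  rw [← hL, evN]
  congr 1
  funext j
  simp [Function.update_apply, Fin.ext_iff]

theorem evN_update_right {m : ℕ} (f : Cochain k A B m) (a : ℕ → A) (b : ℕ → ℕ → B) {i j : ℕ}
    (hij : i < j) (hj : j < m) : ∃ L : B →ₗ[k] A, ∀ x, evN f a (upd₂ b i j x) = L x := by
  obtain ⟨L, hL⟩ := (isMultilinear_ev f).right (fun i => a i) (fun p => b p.1.1 p.1.2)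
    (pr ⟨i, hij.trans hj⟩ ⟨j, hj⟩ hij)
  refine ⟨L, fun x => ?_⟩
  rw [← hL, evN]
  congr 1
  funext p
  simp [Function.update_apply, Subtype.ext_iff, Prod.ext_iff, Fin.ext_iff, upd₂]

/-- A function of matrices indexed by `ℕ` that depends only on the part above the diagonal of the
upper left corner of size `N`, and is linear in each entry there, is a cochain. -/
theorem exists_cochain {N : ℕ} (F : (ℕ → A) → (ℕ → ℕ → B) → A)
    (hF : ∀ a a' b b', (∀ i < N, a i = a' i) → (∀ i j, i < j → j < N → b i j = b' i j) →
      F a b = F a' b')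
    (hl : ∀ a b i, i < N → ∃ L : A →ₗ[k] A, ∀ x, F (Function.update a i x) b = L x)
    (hr : ∀ a b i j, i < j → j < N → ∃ L : B →ₗ[k] A, ∀ x, F a (upd₂ b i j x) = L x) :
    ∃ c : Cochain k A B N, ∀ a b, evN c a b = F a b := by
  -- Finite matrices are extended by 0; by `hF` the values outside the corner are immaterial.
  let eA : (Fin N → A) → ℕ → A := fun a i => if h : i < N then a ⟨i, h⟩ else 0
  let eB : (Pair N → B) → ℕ → ℕ → B := fun b i j =>
    if h : i < j ∧ j < N then b (pr ⟨i, h.1.trans h.2⟩ ⟨j, h.2⟩ h.1) else 0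
  have hM : IsMultilinear k fun (a : Fin N → A) (b : Pair N → B) => F (eA a) (eB b) :=
    { left := fun a b i => by
        obtain ⟨L, hL⟩ := hl (eA a) (eB b) i i.2
        refine ⟨L, fun x => ?_⟩
        rw [← hL]
        refine hF _ _ _ _ (fun j hj => ?_) fun _ _ _ _ => rfl
        simp [eA, hj, Function.update_apply, Fin.ext_iff]
      right := fun a b r => by
        obtain ⟨L, hL⟩ := hr (eA a) (eB b) r.1.1 r.1.2 r.2 r.1.2.2
        refine ⟨L, fun x => ?_⟩
        rw [← hL]
        refine hF _ _ _ _ (fun _ _ => rfl) fun i j hij hj => ?_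
        simp [eB, hij, hj, Function.update_apply, Subtype.ext_iff, Prod.ext_iff, Fin.ext_iff,
          upd₂] }
  refine ⟨mk _ hM, fun a b => ?_⟩
  rw [evN, ev_mk]
  refine hF _ _ _ _ (fun i hi => ?_) fun i j hij hj => ?_
  · simp [eA, hi]
  · simp [eB, hij, hj]

/-- The position `(r, s)` occurs exactly once in the rectangle, and `z` is the product of the other
factors. -/
theorem mg₂_upd₂ {c : ℕ → ℕ} (b : ℕ → ℕ → B) (r s p q : ℕ) (hr : c p ≤ r) (hr' : r < c (p + 1))
    (hs : c q ≤ s) (hs' : s < c (q + 1)) :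
    ∃ z : B, ∀ x, mg₂ c (upd₂ b r s x) p q = x * z := by
  refine ⟨∏ t ∈ (Finset.Ico (c p) (c (p + 1)) ×ˢ Finset.Ico (c q) (c (q + 1))) \ {(r, s)},
    b t.1 t.2, fun x => ?_⟩
  have := Finset.prod_update_of_mem
    (s := Finset.Ico (c p) (c (p + 1)) ×ˢ Finset.Ico (c q) (c (q + 1))) (i := (r, s))
    (by simp [hr, hr', hs, hs']) (fun t : ℕ × ℕ => b t.1 t.2) x
  rw [← this, Finset.prod_product]
  unfold mg₂ mg
  refine Finset.prod_congr rfl fun u _ => Finset.prod_congr rfl fun v _ => ?_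
  simp [upd₂, Function.update_apply]

theorem mg₂_upd₂_of_notMem {c : ℕ → ℕ} (b : ℕ → ℕ → B) (r s p q : ℕ) (x : B)
    (h : ¬ ((c p ≤ r ∧ r < c (p + 1)) ∧ c q ≤ s ∧ s < c (q + 1))) :
    mg₂ c (upd₂ b r s x) p q = mg₂ c b p q := by
  unfold mg₂ mg
  refine Finset.prod_congr rfl fun u hu => Finset.prod_congr rfl fun v hv => ?_
  rw [Finset.mem_Ico] at hu hv
  refine if_neg ?_
  rintro ⟨rfl, rfl⟩
  exact h ⟨hu, hv⟩

end Multilinear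

/-! ### The insertions are cochains -/

section Insertion

variable {k A B : Type*} [CommRing k] [Ring A] [Algebra k A] [CommRing B] [Algebra k B]

/-- The value of `g` on the block that starts at the index `i`. -/
def evAt {n : ℕ} (g : Cochain k A B n) (i : ℕ) (a : ℕ → A) (b : ℕ → ℕ → B) : A :=
  evN g (fun t => a (i + t)) (fun p q => b (i + p) (i + q))

/-- The diagonal of the matrix in which the block of size `l + 1` at `i` is replaced by the value
of `g` on it. -/
def insDiag {l : ℕ} (g : Cochain k A B (l + 1)) (i : ℕ) (a : ℕ → A) (b : ℕ → ℕ → B) : ℕ → A :=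
  insA i l (evAt g i a b) a

/-- The insertion of `g` into the `i`-th argument of `f`, as a function of matrices. -/
def insFun {m l : ℕ} (f : Cochain k A B m) (g : Cochain k A B (l + 1)) (i : ℕ) (a : ℕ → A)
    (b : ℕ → ℕ → B) : A :=
  evN f (insDiag g i a b) (mg₂ (cut i l) b)

theorem evAt_congr {n N : ℕ} (g : Cochain k A B n) (i : ℕ) {a a' : ℕ → A} {b b' : ℕ → ℕ → B}
    (hN : i + n ≤ N) (ha : ∀ j < N, a j = a' j) (hb : ∀ p q, p < q → q < N → b p q = b' p q) :
    evAt g i a b = evAt g i a' b' :=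
  evN_congr g (fun t _ => ha _ (by omega)) fun p q _ _ => hb _ _ (by omega) (by omega)

theorem insFun_congr {m l : ℕ} (f : Cochain k A B m) (g : Cochain k A B (l + 1)) {i : ℕ}
    (hi : i < m) {a a' : ℕ → A} {b b' : ℕ → ℕ → B} (ha : ∀ j < m + l, a j = a' j)
    (hb : ∀ p q, p < q → q < m + l → b p q = b' p q) :
    insFun f g i a b = insFun f g i a' b' := by
  refine evN_congr f (fun t ht => ?_) fun p q hpq hq => ?_
  · unfold insDiag insA
    rw [evAt_congr g i (by omega) ha hb, ha t (by omega), ha (t + l) (by omega)]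
  · refine mg₂_congr (monotone_cut i l) hpq ?_ hb
    have := monotone_cut i l (show q + 1 ≤ m from hq)
    rwa [cut_of_gt hi] at this

theorem insA_eq_update {R : Type*} (i l : ℕ) (z z' : R) (a : ℕ → R) :
    insA i l z a = Function.update (insA i l z' a) i z := by
  funext j
  rcases lt_trichotomy j i with h | rfl | h
  · rw [insA_of_lt _ _ h, Function.update_of_ne h.ne, insA_of_lt _ _ h]
  · rw [insA_self, Function.update_self]
  · rw [insA_of_gt _ _ h, Function.update_of_ne h.ne', insA_of_gt _ _ h]

/-- A cochain is linear in the inserted entry. -/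
theorem exists_linear_insA {m l : ℕ} (f : Cochain k A B m) {i : ℕ} (hi : i < m) (a : ℕ → A)
    (b : ℕ → ℕ → B) : ∃ L : A →ₗ[k] A, ∀ z, evN f (insA i l z a) b = L z := by
  obtain ⟨L, hL⟩ := evN_update_left f (insA i l 0 a) b hi
  exact ⟨L, fun z => by rw [insA_eq_update i l z 0, hL]⟩

/-- An entry of the block is seen only by `g`, whose value enters `f` linearly; any other entry is a
diagonal entry of the compressed matrix. -/
theorem insFun_update_left {m l : ℕ} (f : Cochain k A B m) (g : Cochain k A B (l + 1)) {i : ℕ}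
    (hi : i < m) (a : ℕ → A) (b : ℕ → ℕ → B) {r : ℕ} (hr : r < m + l) :
    ∃ L : A →ₗ[k] A, ∀ x, insFun f g i (Function.update a r x) b = L x := by
  by_cases h : i ≤ r ∧ r ≤ i + l
  · obtain ⟨L, hL⟩ := exists_linear_insA (l := l) f hi a (mg₂ (cut i l) b)
    obtain ⟨M, hM⟩ := evN_update_left g (fun t => a (i + t)) (fun p q => b (i + p) (i + q))
      (show r - i < l + 1 by omega)
    refine ⟨L ∘ₗ M, fun x => ?_⟩
    rw [LinearMap.comp_apply, ← hM, ← hL, insFun, insDiag]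
    congr 1
    funext j
    unfold insA
    split_ifs with h1 h2
    · rw [Function.update_of_ne (by omega)]
    · unfold evAt
      congr 1
      funext t
      simp only [Function.update_apply, show i + t = r ↔ t = r - i by omega]
    · rw [Function.update_of_ne (by omega)]
  · have hev : ∀ x, evAt g i (Function.update a r x) b = evAt g i a b := fun x =>
      evN_congr g (fun t _ => Function.update_of_ne (by omega) _ _) fun _ _ _ _ => rfl
    -- `r'` is the index of the entry `r` once the block has collapsed.
    obtain ⟨r', hr', hne, hrr⟩ : ∃ r' < m, r' ≠ i ∧ ∀ j, j ≠ i →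
        ((if j < i then j else j + l) = r ↔ j = r') := by
      refine ⟨if r < i then r else r - l, ?_, ?_, fun j hj => ?_⟩ <;> split_ifs <;> omega
    obtain ⟨L, hL⟩ := evN_update_left f (insDiag g i a b) (mg₂ (cut i l) b) hr'
    refine ⟨L, fun x => ?_⟩
    rw [← hL, insFun]
    congr 1
    funext j
    have hj := hrr j
    simp only [insDiag, insA, hev, Function.update_apply]
    grind

/-- Each position above the diagonal is used exactly once: by `g` if it lies in the block, and
otherwise as one factor of a single entry of the compressed matrix. -/
theorem insFun_update_right {m l : ℕ} (f : Cochain k A B m) (g : Cochain k A B (l + 1)) {i : ℕ}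
    (hi : i < m) (a : ℕ → A) (b : ℕ → ℕ → B) {r s : ℕ} (hrs : r < s) (hs : s < m + l) :
    ∃ L : B →ₗ[k] A, ∀ x, insFun f g i a (upd₂ b r s x) = L x := by
  by_cases h : i ≤ r ∧ s ≤ i + l
  · obtain ⟨L, hL⟩ := exists_linear_insA (l := l) f hi a (mg₂ (cut i l) b)
    obtain ⟨M, hM⟩ := evN_update_right g (fun t => a (i + t)) (fun p q => b (i + p) (i + q))
      (show r - i < s - i by omega) (show s - i < l + 1 by omega)
    refine ⟨L ∘ₗ M, fun x => ?_⟩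
    rw [LinearMap.comp_apply, ← hM, ← hL, insFun, insDiag]
    have hev : evAt g i a (upd₂ b r s x) = evN g (fun t => a (i + t))
        (upd₂ (fun p q => b (i + p) (i + q)) (r - i) (s - i) x) := by
      unfold evAt
      congr 1
      funext p q
      simp only [upd₂, show i + p = r ↔ p = r - i by omega, show i + q = s ↔ q = s - i by omega]
    rw [hev]
    -- Here `r` and `s` both belong to the part `i`, so no rectangle with `p < q` contains `(r, s)`.
    refine evN_congr f (fun _ _ => rfl) fun p q hpq _ => mg₂_upd₂_of_notMem _ _ _ _ _ _ ?_
    simp only [cut]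
    split_ifs <;> omega
  · have hev : ∀ x, evAt g i a (upd₂ b r s x) = evAt g i a b := fun x =>
      evN_congr g (fun _ _ => rfl) fun p q _ _ => if_neg (by omega)
    -- The intervals between cut points partition `ℕ`, so each index lies in exactly one part.
    have fib : ∀ r, ∃ p, ∀ j, (cut i l j ≤ r ∧ r < cut i l (j + 1)) ↔ j = p := fun r => by
      refine ⟨if r < i then r else if r ≤ i + l then i else r - l, fun j => ?_⟩
      simp only [cut]
      split_ifs <;> omega
    obtain ⟨p, hp⟩ := fib r
    obtain ⟨q, hq⟩ := fib s
    have hp' := (hp p).2 rfl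
    have hq' := (hq q).2 rfl
    have hpq : p < q := by
      simp only [cut] at hp' hq'
      split_ifs at hp' hq' <;> omega
    have hqm : q < m := by
      simp only [cut] at hq'
      split_ifs at hq' <;> omega
    obtain ⟨z, hz⟩ := mg₂_upd₂ (c := cut i l) b r s p q hp'.1 hp'.2 hq'.1 hq'.2
    obtain ⟨L, hL⟩ := evN_update_right f (insDiag g i a b) (mg₂ (cut i l) b) hpq hqm
    refine ⟨L ∘ₗ LinearMap.mulRight k z, fun x => ?_⟩
    rw [LinearMap.comp_apply, LinearMap.mulRight_apply, ← hL, insFun, insDiag, hev]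
    refine evN_congr f (fun _ _ => rfl) fun p' q' _ _ => ?_
    unfold upd₂
    split_ifs with hh
    · rw [hh.1, hh.2]
      exact hz x
    · exact mg₂_upd₂_of_notMem _ _ _ _ _ _ (by rwa [hp, hq])

theorem exists_insertion {m l : ℕ} (f : Cochain k A B m) (g : Cochain k A B (l + 1)) {i : ℕ}
    (hi : i < m) : ∃ c : Cochain k A B (m + l), ∀ a b, evN c a b = insFun f g i a b :=
  exists_cochain _ (fun _ _ _ _ ha hb => insFun_congr f g hi ha hb)
    (fun a b _ hr => insFun_update_left f g hi a b hr)
    fun a b _ _ hrs hs => insFun_update_right f g hi a b hrs hs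

end Insertion

/-! ### Cofaces of an insertion -/

section Identities

variable {k A B : Type*} [CommRing k] [Ring A] [Algebra k A] [CommRing B] [Algebra k B]
  (ε : B →ₐ[k] A) {m l : ℕ} (f : Cochain k A B m) (g : Cochain k A B (l + 1))
  {c : Cochain k A B (m + l)} {i : ℕ}

theorem face_zero_insertion (hc : ∀ a b, evN c a b = insFun f g i a b) (hi : i < m) (a : ℕ → A)
    (b : ℕ → ℕ → B) :
    face ε c a b 0 = face ε f (insDiag g (i + 1) a b) (mg₂ (cut (i + 1) l) b) 0 := by
  rw [face_zero, face_zero, hc, insDiag, insA_of_lt _ _ (Nat.succ_pos i),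
    prod_mg₂_right (monotone_cut _ _) b (by omega), cut_of_le (by omega), cut_of_le (by omega),
    cut_of_gt (by omega), mg₂_shift (monotone_cut _ _), insFun, shift_mg₂ (monotone_cut _ _)]
  congr 1
  · simp [add_right_comm]
  · refine evN_congr f (fun t _ => ?_) fun p q _ _ => ?_
    · unfold insDiag insA evAt
      simp only [add_comm 1]
      split_ifs <;> first | omega | rfl | simp only [add_right_comm]
    · refine mg₂_congr_cut b ?_ ?_ ?_ ?_ <;> simp only [cut] <;> split_ifs <;> omega

/-- Merging to the left of the block moves it one step left: the block at `i` after merging is the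
block at `i + 1` before. This is why `i + 1` appears on the right. -/
theorem mergeFace_insertion_of_lt (hc : ∀ a b, evN c a b = insFun f g i a b) {j : ℕ} (hj : j < i)
    (a : ℕ → A) (b : ℕ → ℕ → B) :
    mergeFace ε c j a b =
      mergeFace ε f j (insDiag g (i + 1) a b) (mg₂ (cut (i + 1) l) b) := by
  have hb : mg₂ (cut (i + 1) l) b j (j + 1) = b j (j + 1) := by
    rw [mg₂_congr_cut (c' := fun p => p) (p' := j) (q' := j + 1) b (cut_of_le (by omega))
      (cut_of_le (by omega)) (cut_of_le (by omega)) (cut_of_le (by omega)), mg₂_id]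
  rw [mergeFace, mergeFace, hc, insFun, mg₂_mg₂ (monotone_cut _ _) (monotone_cut _ _),
    mg₂_mg₂ (monotone_cut _ _) (monotone_cut _ _), hb]
  refine evN_congr f (fun t _ => ?_) fun p q _ _ => ?_
  · have hev : evAt g i (insA j 1 (ε (b j (j + 1)) * a j * a (j + 1)) a) (mg₂ (cut j 1) b) =
        evAt g (i + 1) a b := by
      unfold evAt
      congr 1
      · funext t
        rw [insA_of_gt _ _ (by omega), add_right_comm]
      · rw [mg₂_shift (monotone_cut _ _), ← mg₂_add]
        congr 1
        funext p
        rw [cut_of_gt (by omega), add_right_comm]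
    simp only [insDiag, hev]
    simp only [insA]
    split_ifs <;> first | omega | rfl | simp only [add_right_comm]
  · refine mg₂_congr_cut b ?_ ?_ ?_ ?_ <;> simp only [cut] <;> split_ifs <;> omega

/-- The merged row and column lie in the block, so `g` sees a block of size `l + 2` with two
neighbours merged, while `f` sees all of that block collapsed. -/
theorem mergeFace_insertion_of_mem (hc : ∀ a b, evN c a b = insFun f g i a b) {t : ℕ}
    (ht : t ≤ l) (a : ℕ → A) (b : ℕ → ℕ → B) :
    mergeFace ε c (i + t) a b =
      evN f (insA i (l + 1) (mergeFace ε g t (fun t => a (i + t)) (fun p q => b (i + p) (i + q))) a)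
        (mg₂ (cut i (l + 1)) b) := by
  rw [mergeFace, hc, insFun, mg₂_mg₂ (monotone_cut _ _) (monotone_cut _ _)]
  refine evN_congr f (fun j _ => ?_) fun p q _ _ => ?_
  · rcases lt_trichotomy j i with h | rfl | h
    · rw [insDiag, insA_of_lt _ _ h, insA_of_lt _ _ h, insA_of_lt _ _ (by omega)]
    · rw [insDiag, insA_self, insA_self, evAt, mergeFace, shift_mg₂ (monotone_cut _ _),
        mg₂_shift (monotone_cut _ _)]
      congr 1
      · funext s
        simp only [insA]
        split_ifs <;> first | omega | rfl
      · congr 1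
        funext p
        simp only [cut]
        split_ifs <;> omega
    · rw [insDiag, insA_of_gt _ _ h, insA_of_gt _ _ h, insA_of_gt _ _ (by omega)]
      rfl
  · refine mg₂_congr_cut b ?_ ?_ ?_ ?_ <;> simp only [cut] <;> split_ifs <;> omega

/-- To the right of the block, collapsing lowers indices by `l`, and the block itself is untouched.
-/
theorem mergeFace_insertion_of_gt (hc : ∀ a b, evN c a b = insFun f g i a b) {j : ℕ} (hj : i < j)
    (a : ℕ → A) (b : ℕ → ℕ → B) :
    mergeFace ε c (j + l) a b =
      mergeFace ε f j (insDiag g i a b) (mg₂ (cut i l) b) := by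
  have hb : mg₂ (cut i l) b j (j + 1) = b (j + l) (j + l + 1) := by
    rw [mg₂_congr_cut (c' := fun p => p) (p' := j + l) (q' := j + l + 1) b (cut_of_gt (by omega))
      (by rw [cut_of_gt (by omega)]; omega) (by rw [cut_of_gt (by omega)]; omega)
      (by rw [cut_of_gt (by omega)]; omega), mg₂_id]
  rw [mergeFace, mergeFace, hc, insFun, mg₂_mg₂ (monotone_cut _ _) (monotone_cut _ _),
    mg₂_mg₂ (monotone_cut _ _) (monotone_cut _ _), hb]
  refine evN_congr f (fun t _ => ?_) fun p q _ _ => ?_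
  · have hev : evAt g i (insA (j + l) 1 (ε (b (j + l) (j + l + 1)) * a (j + l) * a (j + l + 1)) a)
        (mg₂ (cut (j + l) 1) b) = evAt g i a b := by
      refine evN_congr g (fun t _ => insA_of_lt _ _ (by omega)) fun p q _ _ => ?_
      rw [mg₂_congr_cut (c' := fun p => p) (p' := i + p) (q' := i + q) b (cut_of_le (by omega))
        (cut_of_le (by omega)) (cut_of_le (by omega)) (cut_of_le (by omega)), mg₂_id]
    simp only [insDiag, hev]
    simp only [insA]
    split_ifs <;> first | omega | rfl | simp only [add_right_comm]
  · refine mg₂_congr_cut b ?_ ?_ ?_ ?_ <;> simp only [cut] <;> split_ifs <;> omega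

theorem face_last_insertion (hc : ∀ a b, evN c a b = insFun f g i a b) (hi : i < m) (a : ℕ → A)
    (b : ℕ → ℕ → B) :
    face ε c a b (m + l + 1) = face ε f (insDiag g i a b) (mg₂ (cut i l) b) (m + 1) := by
  rw [face_last, face_last, hc, prod_mg₂_left (monotone_cut _ _) b (by omega),
    cut_of_le (Nat.zero_le i), cut_of_gt hi, cut_of_gt (by omega), insDiag, insA_of_gt _ _ hi,
    add_right_comm m 1 l]
  simp only [Nat.Ico_succ_singleton, Finset.prod_singleton]
  rfl

/-- The first outer coface of `g` multiplies its value on the block at `i + 1` by `a i` and by the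
entries of row `i` over that block. Their product is the entry at `(i, i + 1)` after insertion, so
this is a merging for `f`, once `ε` is moved past `a i` by centrality. -/
theorem insert_face_zero (hε : ∀ x, ε x ∈ Subalgebra.center k A) (a : ℕ → A) (b : ℕ → ℕ → B) :
    evN f (insA i (l + 1) (face ε g (fun t => a (i + t)) (fun p q => b (i + p) (i + q)) 0) a)
        (mg₂ (cut i (l + 1)) b) =
      mergeFace ε f i (insDiag g (i + 1) a b) (mg₂ (cut (i + 1) l) b) := by
  have hb : mg₂ (cut (i + 1) l) b i (i + 1) = ∏ j ∈ Finset.Ico 1 (l + 1 + 1), b i (i + j) := by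
    rw [mg₂, mg, cut_of_le (by omega), cut_of_le (by omega), Nat.Ico_succ_singleton,
      Finset.prod_singleton, mg, cut_of_le (by omega), cut_of_gt (by omega),
      Finset.prod_Ico_add (fun j => b i j) 1 (l + 1 + 1) i]
    congr 2 <;> omega
  rw [mergeFace, mg₂_mg₂ (monotone_cut _ _) (monotone_cut _ _), hb]
  refine evN_congr f (fun j _ => ?_) fun p q _ _ => ?_
  · rcases lt_trichotomy j i with h | rfl | h
    · rw [insDiag, insA_of_lt _ _ h, insA_of_lt _ _ h, insA_of_lt _ _ (by omega)]
    · rw [insDiag, insA_self, insA_self, insA_self, insA_of_lt _ _ (Nat.lt_succ_self j), face_zero,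
        Subalgebra.mem_center_iff.1 (hε _) (a (j + 0))]
      simp only [evAt, add_assoc, add_zero]
    · rw [insDiag, insA_of_gt _ _ h, insA_of_gt _ _ h, insA_of_gt _ _ (by omega)]
      congr 1
      omega
  · refine mg₂_congr_cut b ?_ ?_ ?_ ?_ <;> simp only [cut] <;> split_ifs <;> omega

/-- The mirror image: the factor on the right of the block at `i` is absorbed by merging the
inserted entry with its right neighbour. -/
theorem insert_face_last (hε : ∀ x, ε x ∈ Subalgebra.center k A) (a : ℕ → A) (b : ℕ → ℕ → B) :
    evN f (insA i (l + 1)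
        (face ε g (fun t => a (i + t)) (fun p q => b (i + p) (i + q)) (l + 1 + 1)) a)
        (mg₂ (cut i (l + 1)) b) =
      mergeFace ε f i (insDiag g i a b) (mg₂ (cut i l) b) := by
  have hb : mg₂ (cut i l) b i (i + 1) = ∏ j ∈ Finset.Ico 0 (l + 1), b (i + j) (i + (l + 1)) := by
    rw [mg₂, mg, cut_of_le le_rfl, cut_of_gt (by omega),
      Finset.prod_Ico_add (fun j => b j (i + (l + 1))) 0 (l + 1) i]
    refine Finset.prod_congr (by congr 1 <;> omega) fun r _ => ?_
    rw [mg, cut_of_gt (by omega), cut_of_gt (by omega),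
      show i + 1 + 1 + l = i + 1 + l + 1 by omega, Nat.Ico_succ_singleton, Finset.prod_singleton]
    congr 1
    omega
  rw [mergeFace, mg₂_mg₂ (monotone_cut _ _) (monotone_cut _ _), hb]
  refine evN_congr f (fun j _ => ?_) fun p q _ _ => ?_
  · rcases lt_trichotomy j i with h | rfl | h
    · rw [insDiag, insA_of_lt _ _ h, insA_of_lt _ _ h, insA_of_lt _ _ (by omega)]
    · rw [insDiag, insA_self, insA_self, insA_self, insA_of_gt _ _ (Nat.lt_succ_self j), face_last,
        Subalgebra.mem_center_iff.1 (hε _), mul_assoc]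
      simp only [evAt, Nat.succ_eq_add_one, add_assoc, add_comm 1]
    · rw [insDiag, insA_of_gt _ _ h, insA_of_gt _ _ h, insA_of_gt _ _ (by omega)]
      congr 1
      omega
  · refine mg₂_congr_cut b ?_ ?_ ?_ ?_ <;> simp only [cut] <;> split_ifs <;> omega

/-- With `g` inserted at the first place, the first coface of `f` splits off exactly the value of
`g`, and the first row of the compressed matrix multiplies to all entries between the two blocks. -/
theorem face_zero_insDiag_zero (a : ℕ → A) (b : ℕ → ℕ → B) :
    face ε f (insDiag g 0 a b) (mg₂ (cut 0 l) b) 0 = evN (cupC ε (l + 1) m g f) a b := by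
  rw [face_zero, evN_cup, prod_mg₂_right (monotone_cut _ _) b (by omega), insDiag, insA_self,
    mg₂_shift (monotone_cut _ _)]
  have h1 : ∀ p, cut 0 l (1 + p) = l + 1 + p := fun p => by rw [cut_of_gt (by omega)]; omega
  have h2 : ∀ p, cut 0 l (p + 1) = p + 1 + l := fun p => cut_of_gt (by omega)
  congr 1
  · congr 2
    · simp [evAt]
    · rw [cut_of_le le_rfl, h2, h2, Finset.range_eq_Ico]
      refine Finset.prod_congr (by congr 1; omega) fun r _ => ?_
      rw [Finset.range_eq_Ico, Finset.prod_Ico_add (fun j => b r j) 0 m (l + 1)]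
      congr 2 <;> omega
  · simp only [h1, mg₂_add]
    congr 1
    funext t
    rw [insA_of_gt _ _ (by omega)]
    congr 1
    omega

/-- Dual to the previous case, except that the last coface has `ε` on the far right; centrality
moves it between the two values. -/
theorem face_last_insDiag_last (hε : ∀ x, ε x ∈ Subalgebra.center k A) (a : ℕ → A)
    (b : ℕ → ℕ → B) :
    face ε f (insDiag g m a b) (mg₂ (cut m l) b) (m + 1) = evN (cupC ε m (l + 1) f g) a b := by
  rw [face_last, evN_cup, prod_mg₂_left (monotone_cut _ _) b (by omega), insDiag, insA_self,
    mul_assoc, Subalgebra.mem_center_iff.1 (hε _), ← mul_assoc]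
  congr 1
  congr 1
  · refine evN_congr f (fun j hj => insA_of_lt _ _ hj) fun p q _ _ => ?_
    rw [mg₂_congr_cut (c' := fun p => p) (p' := p) (q' := q) b (cut_of_le (by omega))
      (cut_of_le (by omega)) (cut_of_le (by omega)) (cut_of_le (by omega)), mg₂_id]
  · rw [cut_of_le (Nat.zero_le m), cut_of_le le_rfl, cut_of_gt (Nat.lt_succ_self m),
      Finset.range_eq_Ico]
    refine congrArg ε (Finset.prod_congr rfl fun r _ => ?_)
    rw [Finset.range_eq_Ico, Finset.prod_Ico_add (fun j => b r j) 0 (l + 1) m]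
    congr 2 <;> omega

end Identities

/-! ### The telescoping homotopy -/

section Homotopy

variable {k A B : Type*} [CommRing k] [Ring A] [Algebra k A] [CommRing B] [Algebra k B]
  (ε : B →ₐ[k] A)

/-- The alternating sum of the first `i + 1` cofaces of `f` on the matrix in which `g` is inserted
at `i`. -/
def partialSum {m l : ℕ} (f : Cochain k A B m) (g : Cochain k A B (l + 1)) (a : ℕ → A)
    (b : ℕ → ℕ → B) (i : ℕ) : A :=
  ∑ j ∈ Finset.range (i + 1), (-1 : k) ^ j • face ε f (insDiag g i a b) (mg₂ (cut i l) b) j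

theorem d_insertion (hε : ∀ x, ε x ∈ Subalgebra.center k A) {m l : ℕ} {f : Cochain k A B m}
    {g : Cochain k A B (l + 1)} (hf : f ∈ cocycles ε m) (hg : g ∈ cocycles ε (l + 1)) {i : ℕ}
    (hi : i < m) {c : Cochain k A B (m + l)} (hc : ∀ a b, evN c a b = insFun f g i a b)
    (a : ℕ → A) (b : ℕ → ℕ → B) :
    evN (d ε (m + l) c) a b =
      partialSum ε f g a b (i + 1) - (-1 : k) ^ l • partialSum ε f g a b i := by
  set F := face ε f (insDiag g i a b) (mg₂ (cut i l) b) with hF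
  set F' := face ε f (insDiag g (i + 1) a b) (mg₂ (cut (i + 1) l) b) with hF'
  obtain ⟨L, hL⟩ := exists_linear_insA (l := l + 1) f hi a (mg₂ (cut i (l + 1)) b)
  set G := face ε g (fun t => a (i + t)) (fun p q => b (i + p) (i + q)) with hG
  have first : ∀ j ∈ Finset.range (i + 1), face ε c a b j = F' j := by
    intro j hj
    rw [Finset.mem_range] at hj
    cases j with
    | zero => exact face_zero_insertion ε f g hc hi a b
    | succ j =>
      rw [face_succ ε c a b (by omega), hF', face_succ ε f _ _ (by omega),
        mergeFace_insertion_of_lt ε f g hc (by omega)]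
  have middle : ∀ t ∈ Finset.range (l + 1), face ε c a b (i + 1 + t) = L (G (t + 1)) := by
    intro t ht
    rw [Finset.mem_range] at ht
    rw [show i + 1 + t = i + t + 1 by omega, face_succ ε c a b (by omega),
      mergeFace_insertion_of_mem ε f g hc (by omega), hL, hG, face_succ ε g _ _ ht]
  -- `r` counts the arguments of `f` to the right of `i`; the right-hand group consists of `r`
  -- mergings and the last coface.
  obtain ⟨r, rfl⟩ : ∃ r, m = i + 1 + r := ⟨m - (i + 1), by omega⟩
  have last : ∀ t ∈ Finset.range (r + 1),
      face ε c a b (i + 1 + (l + 1) + t) = F (i + 2 + t) := by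
    intro t ht
    rw [Finset.mem_range] at ht
    rcases (show t < r ∨ t = r by omega) with h | rfl
    · rw [show i + 1 + (l + 1) + t = i + 1 + t + l + 1 by omega, face_succ ε c a b (by omega),
        mergeFace_insertion_of_gt ε f g hc (by omega), hF,
        show i + 2 + t = i + 1 + t + 1 by omega, face_succ ε f _ _ (by omega)]
    · rw [show i + 1 + (l + 1) + t = i + 1 + t + l + 1 by omega,
        face_last_insertion ε f g hc hi, show i + 2 + t = i + 1 + t + 1 by omega]
  have Z0 : L (G 0) = F' (i + 1) := by
    rw [← hL, hG, insert_face_zero ε f g hε, hF', face_succ ε f _ _ hi]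
  have Z1 : L (G (l + 1 + 1)) = F (i + 1) := by
    rw [← hL, hG, insert_face_last ε f g hε, hF, face_succ ε f _ _ hi]
  -- The cocycle identity of `g` on the block of size `l + 2`, carried through `f` by the linear map
  -- `L`.
  have sumG : F' (i + 1) + ∑ t ∈ Finset.range (l + 1), (-1 : k) ^ (t + 1) • L (G (t + 1)) +
      (-1 : k) ^ l • F (i + 1) = 0 := by
    have h := congrArg L (sum_face_eq_zero ε hg (fun t => a (i + t))
      (fun p q => b (i + p) (i + q)))
    rw [← hG, Finset.sum_range_succ, Finset.sum_range_succ'] at h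
    simp only [map_add, map_sum, map_smul, map_zero, pow_zero, one_smul, Z0, Z1] at h
    rw [← h, pow_succ, pow_succ]
    simp only [mul_neg, mul_one, neg_neg]
    abel
  have sumF : ∑ j ∈ Finset.range (i + 1), (-1 : k) ^ j • F j + (-1 : k) ^ (i + 1) • F (i + 1) +
      ∑ t ∈ Finset.range (r + 1), (-1 : k) ^ (i + 2 + t) • F (i + 2 + t) = 0 := by
    have h := sum_face_eq_zero ε hf (insDiag g i a b) (mg₂ (cut i l) b)
    rw [← hF, show i + 1 + r + 2 = i + 2 + (r + 1) by omega, Finset.sum_range_add,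
      Finset.sum_range_succ _ (i + 1)] at h
    exact h
  have hmid : ∑ t ∈ Finset.range (l + 1), (-1 : k) ^ (i + 1 + t) • L (G (t + 1)) =
      (-1 : k) ^ i • ∑ t ∈ Finset.range (l + 1), (-1 : k) ^ (t + 1) • L (G (t + 1)) := by
    rw [Finset.smul_sum]
    refine Finset.sum_congr rfl fun t _ => ?_
    rw [smul_smul, ← pow_add, show i + 1 + t = i + (t + 1) by omega]
  have hlast : ∑ t ∈ Finset.range (r + 1), (-1 : k) ^ (i + 1 + (l + 1) + t) • F (i + 2 + t) =
      (-1 : k) ^ l • ∑ t ∈ Finset.range (r + 1), (-1 : k) ^ (i + 2 + t) • F (i + 2 + t) := by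
    rw [Finset.smul_sum]
    refine Finset.sum_congr rfl fun t _ => ?_
    rw [smul_smul, ← pow_add, show i + 1 + (l + 1) + t = l + (i + 2 + t) by omega]
  rw [evN_d_eq_sum_face, show i + 1 + r + l + 2 = i + 1 + (l + 1) + (r + 1) by omega,
    Finset.sum_range_add, Finset.sum_range_add,
    Finset.sum_congr rfl fun j hj => congrArg _ (first j hj),
    Finset.sum_congr rfl fun j hj => congrArg (fun z => (-1 : k) ^ (i + 1 + j) • z) (middle j hj),
    Finset.sum_congr rfl fun j hj =>
      congrArg (fun z => (-1 : k) ^ (i + 1 + (l + 1) + j) • z) (last j hj),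
    hmid, hlast, partialSum, partialSum, ← hF, ← hF', Finset.sum_range_succ _ (i + 1)]
  rw [add_assoc, add_eq_zero_iff_eq_neg'] at sumG
  rw [add_eq_zero_iff_eq_neg'] at sumF
  have hmid' : ∑ t ∈ Finset.range (l + 1), (-1 : k) ^ (t + 1) • L (G (t + 1)) =
      -F' (i + 1) - (-1 : k) ^ l • F (i + 1) := by
    rw [← sumG]; abel
  -- Both relations contribute `F (i + 1)`, with opposite signs, so it drops out; `F' (i + 1)`
  -- completes the partial sum at `i + 1`.
  rw [sumF, hmid']
  simp only [pow_succ _ i]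
  module

/-- As `e` is its own inverse, each summand is `e` times a difference of consecutive values of `e ^
i • U i`. -/
theorem sum_telescope {M : Type*} [AddCommGroup M] [Module k M] {e : k} (he : e * e = 1)
    (U : ℕ → M) (m : ℕ) :
    ∑ i ∈ Finset.range m, e ^ i • (U (i + 1) - e • U i) = e • (e ^ m • U m - U 0) := by
  have h := Finset.sum_range_sub (fun i => e ^ i • U i) m
  rw [pow_zero, one_smul] at h
  rw [← h, Finset.smul_sum]
  refine Finset.sum_congr rfl fun i _ => ?_
  rw [smul_sub, smul_sub, smul_smul, smul_smul, smul_smul,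
    show e * e ^ (i + 1) = e ^ i by rw [pow_succ', ← mul_assoc, he, one_mul], mul_comm]

theorem partialSum_last (hε : ∀ x, ε x ∈ Subalgebra.center k A) {m l : ℕ} {f : Cochain k A B m}
    (g : Cochain k A B (l + 1)) (hf : f ∈ cocycles ε m) (a : ℕ → A) (b : ℕ → ℕ → B) :
    partialSum ε f g a b m = (-1 : k) ^ m • evN (cupC ε m (l + 1) f g) a b := by
  have h := sum_face_eq_zero ε hf (insDiag g m a b) (mg₂ (cut m l) b)
  rw [Finset.sum_range_succ, face_last_insDiag_last ε f g hε, add_eq_zero_iff_eq_neg] at h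
  rw [partialSum, h, pow_succ]
  simp

theorem evN_sum {ι : Type*} {n : ℕ} (s : Finset ι) (f : ι → Cochain k A B n) (a : ℕ → A)
    (b : ℕ → ℕ → B) : evN (∑ i ∈ s, f i) a b = ∑ i ∈ s, evN (f i) a b :=
  map_sum (AddMonoidHom.mk' (fun f : Cochain k A B n => evN f a b) fun f g => evN_add f g a b) f s

/-- For `m = 0` the sum of insertions is empty, and the two cup products agree already as functions
of matrices. -/
theorem exists_homotopy (hε : ∀ x, ε x ∈ Subalgebra.center k A) {m l : ℕ} {f : Cochain k A B m}
    {g : Cochain k A B (l + 1)} (hf : f ∈ cocycles ε m) (hg : g ∈ cocycles ε (l + 1)) :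
    ∃ z : Cochain k A B (m + l), ∀ a b, evN (d ε (m + l) z) a b =
      evN (cupC ε m (l + 1) f g) a b -
        (-1 : k) ^ (m * (l + 1)) • evN (cupC ε (l + 1) m g f) a b := by
  -- The value 0 for `i ≥ m` never enters the sum below.
  choose c hc using fun i : ℕ => show ∃ c : Cochain k A B (m + l),
      i < m → ∀ a b, evN c a b = insFun f g i a b by
    by_cases hi : i < m
    · obtain ⟨c, hc⟩ := exists_insertion f g hi
      exact ⟨c, fun _ => hc⟩
    · exact ⟨0, fun h => absurd h hi⟩
  set e : k := (-1) ^ l with he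
  have he' : e * e = 1 := by rw [he, ← mul_pow]; simp
  -- The telescoped sum is `e` times the difference of (-1)^(m(l+1)) f ⌣ g and g ⌣ f. Both signs
  -- square to 1, so this factor gives f ⌣ g the coefficient 1.
  refine ⟨((-1 : k) ^ (m * (l + 1)) * e) • ∑ i ∈ Finset.range m, e ^ i • c i, fun a b => ?_⟩
  have key : evN (d ε (m + l) (∑ i ∈ Finset.range m, e ^ i • c i)) a b =
      e • (e ^ m • partialSum ε f g a b m - partialSum ε f g a b 0) := by
    rw [← sum_telescope he', map_sum, evN_sum]
    refine Finset.sum_congr rfl fun i hi => ?_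
    rw [Finset.mem_range] at hi
    rw [map_smul, evN_smul, d_insertion ε hε hf hg hi (hc i hi)]
  have h0 : partialSum ε f g a b 0 = evN (cupC ε (l + 1) m g f) a b := by
    simp [partialSum, face_zero_insDiag_zero]
  have hs : e ^ m * (-1 : k) ^ m = (-1) ^ (m * (l + 1)) := by
    rw [he, ← pow_mul, ← pow_add]
    congr 1
    ring
  have hq : (-1 : k) ^ (m * (l + 1)) * (-1) ^ (m * (l + 1)) = 1 := by rw [← mul_pow]; simp
  rw [map_smul, evN_smul, key, h0, partialSum_last ε hε g hf, smul_smul (e ^ m), hs,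
    smul_smul, mul_assoc, he', mul_one, smul_sub, smul_smul, hq, one_smul]

/-! ### Passage to cohomology -/

/-- The degrees of f ⌣ g and g ⌣ f are equal but not definitionally so. Evaluation on matrices
indexed by `ℕ` and the direct sum allow the comparison without a cast. -/
theorem lof_cls_eq {M N P : ℕ} (hMN : M = N) (hP : P + 1 = M) (x : cocycles ε M)
    (y : cocycles ε N) (z : Cochain k A B P)
    (h : ∀ a b, evN (d ε P z) a b = evN x.1 a b - evN y.1 a b) :
    DirectSum.lof k ℕ (Cohomology ε) M (cls ε M x) =
      DirectSum.lof k ℕ (Cohomology ε) N (cls ε N y) := by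
  subst hMN
  congr 1
  refine (Submodule.Quotient.eq _).2 (mem_coboundaries_of_evN ε hP z _ fun a b => ?_)
  rw [h]
  exact (map_sub (AddMonoidHom.mk' (fun f : Cochain k A B M => evN f a b)
    fun f g => evN_add f g a b) x.1 y.1).symm

theorem cup_comm_of_succ (hε : ∀ x, ε x ∈ Subalgebra.center k A) (m l : ℕ)
    (x : Cohomology ε m) (y : Cohomology ε (l + 1)) :
    cup ε hε (DirectSum.lof k ℕ (Cohomology ε) m x)
        (DirectSum.lof k ℕ (Cohomology ε) (l + 1) y) =
      (-1 : k) ^ (m * (l + 1)) • cup ε hε (DirectSum.lof k ℕ (Cohomology ε) (l + 1) y)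
        (DirectSum.lof k ℕ (Cohomology ε) m x) := by
  obtain ⟨f, rfl⟩ := Submodule.Quotient.mk_surjective _ x
  obtain ⟨g, rfl⟩ := Submodule.Quotient.mk_surjective _ y
  obtain ⟨z, hz⟩ := exists_homotopy ε hε f.2 g.2
  change cup ε hε (DirectSum.lof k ℕ _ m (cls ε m f))
      (DirectSum.lof k ℕ _ (l + 1) (cls ε (l + 1) g)) =
    _ • cup ε hε (DirectSum.lof k ℕ _ (l + 1) (cls ε (l + 1) g))
      (DirectSum.lof k ℕ _ m (cls ε m f))
  rw [cup_lof, cup_lof, cupH_cls, cupH_cls, ← map_smul, ← map_smul]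
  exact lof_cls_eq ε (by omega) (by omega) _ _ z hz

/-- A 0-cochain is an element of `A`, and its coboundary is the commutator with the diagonal entry,
so cocycles of degree 0 commute with everything. -/
theorem cup_comm_zero (hε : ∀ x, ε x ∈ Subalgebra.center k A) (x y : Cohomology ε 0) :
    cup ε hε (DirectSum.lof k ℕ (Cohomology ε) 0 x) (DirectSum.lof k ℕ (Cohomology ε) 0 y) =
      cup ε hε (DirectSum.lof k ℕ (Cohomology ε) 0 y)
        (DirectSum.lof k ℕ (Cohomology ε) 0 x) := by
  obtain ⟨f, rfl⟩ := Submodule.Quotient.mk_surjective _ x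
  obtain ⟨g, rfl⟩ := Submodule.Quotient.mk_surjective _ y
  change cup ε hε (DirectSum.lof k ℕ _ 0 (cls ε 0 f)) (DirectSum.lof k ℕ _ 0 (cls ε 0 g)) =
    cup ε hε (DirectSum.lof k ℕ _ 0 (cls ε 0 g)) (DirectSum.lof k ℕ _ 0 (cls ε 0 f))
  rw [cup_lof, cup_lof, cupH_cls, cupH_cls]
  congr 2
  refine Subtype.ext (evN_ext fun a b => ?_)
  -- A 0-cochain reads no entries, so both conditions of the congruence are vacuous.
  have hcongr : ∀ (h : Cochain k A B 0) (a a' : ℕ → A) (b b' : ℕ → ℕ → B),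
      evN h a b = evN h a' b' := fun h _ _ _ _ => evN_congr h (by omega) (by omega)
  -- The cocycle identity of `f` on the 1 × 1 matrix whose entry is the value of `g`.
  have h := sum_face_eq_zero ε f.2 (fun _ => evN g.1 a b) b
  rw [Finset.sum_range_succ, Finset.sum_range_one, face_last, face_zero] at h
  simp only [pow_zero, one_smul, zero_add, pow_one, Finset.Ico_self, Finset.prod_empty, map_one,
    mul_one, neg_smul] at h
  rw [evN_cup, evN_cup]
  simp only [Finset.range_zero, Finset.prod_empty, map_one, mul_one]
  rw [hcongr f.1 _ a _ b, hcongr f.1 (fun _ => evN g.1 a b) a b b, add_neg_eq_zero] at h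
  rw [hcongr g.1 (fun i => a (0 + i)) a _ b, hcongr f.1 (fun i => a (0 + i)) a _ b, h]

end Homotopy

end SecondaryHochschild

end

theorem mainTheorem4 {k A B : Type*} [Field k] [Ring A] [Algebra k A] [CommRing B] [Algebra k B]
    (ε : B →ₐ[k] A) (hε : ∀ b, ε b ∈ Subalgebra.center k A) (m n : ℕ)
    (x : SecondaryHochschild.Cohomology ε m) (y : SecondaryHochschild.Cohomology ε n) :
    SecondaryHochschild.cup ε hε
        (DirectSum.lof k ℕ (SecondaryHochschild.Cohomology ε) m x)
        (DirectSum.lof k ℕ (SecondaryHochschild.Cohomology ε) n y) =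
      (-1 : k) ^ (m * n) •
        SecondaryHochschild.cup ε hε
          (DirectSum.lof k ℕ (SecondaryHochschild.Cohomology ε) n y)
          (DirectSum.lof k ℕ (SecondaryHochschild.Cohomology ε) m x) := by
  cases n with
  | succ l => exact SecondaryHochschild.cup_comm_of_succ ε hε m l x y
  | zero =>
    rw [mul_zero, pow_zero, one_smul]
    cases m with
    | zero => exact SecondaryHochschild.cup_comm_zero ε hε x y
    | succ l =>
      -- The roles are exchanged: `x` has positive degree and is the class that gets inserted; the
      -- sign is trivial.
      rw [SecondaryHochschild.cup_comm_of_succ ε hε 0 l y x, zero_mul, pow_zero, one_smul]
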